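/- **Theorem (Itô type formula).** Let $2\le p<3$, $\gamma>p$, $0<q\le p/2$, $T>0$ and $d,e\in\mathbb N$. Let $X=(1,X^1,X^2)$ be a geometric $p$-rough path over $[0,T]$ in $\mathbb R^d$, that is, a continuous map on $\{0\le s\le t\le T\}$ satisfying Chen's identity, of finite $p$-variation ($X^1$ has finite $p$-variation and $X^2$ finite $p/2$-variation), which is a limit in the $p$-variation distance of canonical lifts of continuous paths of bounded variation. Write $X_t:=X^1_{0,t}$. Let $\varphi:[0,T]\to\mathbb R^d\otimes\mathbb R^d$ be continuous and of finite $q$-variation, and let $X(\varphi)_{s,t}:=(1,\,X^1_{s,t},\,X^2_{s,t}-(\varphi_t-\varphi_s))$. Let $F:\mathbb R^d\to\mathbb R^e$ be a $\mathrm{Lip}(\gamma)$ function in the sense of Stein: with $k$ the integer such that $k<\gamma\le k+1$, $F$ is $C^k$, $F,DF,\dots,D^kF$ are bounded, and $D^kF$ is Hölder continuous of exponent $\gamma-k$. For a $p$-rough path $Z$ and a one-form $f:\mathbb R^d\to L(\mathbb R^d,\mathbb R^e)$, the rough integral $\int f(Z)\,dZ=(1,\int f(Z)\,dZ^1,\int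 f(Z)\,dZ^2)$ is the $p$-rough path in $\mathbb R^e$ whose levels differ from $f(Z_s)Z^1_{s,t}+Df(Z_s)Z^2_{s,t}$ and $\big(f(Z_s)\otimes f(Z_s)\big)Z^2_{s,t}$, respectively, by at most $\omega(s,t)^\theta$ for some control $\omega$ (non-negative, continuous, super-additive, zero on the diagonal) and some $\theta>1$. Put $F_{\mathfrak R}(X):=\int DF(X)\,dX$. Then $X(\varphi)$ is a $p$-rough path, the rough integrals $\int DF(X)\,dX$ and $\int DF(X(\varphi))\,dX(\varphi)$ exist, and for all $0\le s\le t\le T$: (i) $F_{\mathfrak R}(X)^1_{s,t}=F(X_t)-F(X_s)$. (ii) $\displaystyle F(X_t)-F(X_s)=\int_s^t DF(X(\varphi))\,dX(\varphi)^1+\int_s^t D^2F(X_u)\,d\varphi_u$, where the last integral exists as a Young integral. (iii) With $J_{s,u}:=\int_s^u D^2F(X_r)\,d\varphi_r$, $$\begin{aligned}F_{\mathfrak R}(X)^2_{s,t}&=\int_s^t DF(X(\varphi))\,dX(\varphi)^2+\int_s^t DF(X_u)\otimes DF(X_u)\,d\varphi_u+\int_s^t J_{s,u}\otimes dF(X_u)\\&\quad+\int_s^t\big(F(X_u)-F(X_s)\big)\otimes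 D^2F(X_u)\,d\varphi_u-\int_s^t J_{s,u}\otimes D^2F(X_u)\,d\varphi_u,\end{aligned}$$ where the last four integrals exist as Young integrals. Here a Young integral $\int_s^tY\,dZ$ is the limit of the Riemann–Stieltjes sums $\sum_l Y_{\xi_l}(Z_{t_l}-Z_{t_{l-1}})$, with arbitrary tags $\xi_l\in[t_{l-1},t_l]$, as the mesh tends to $0$, for $Y$ and $Z$ of finite $\alpha$- and $\beta$-variation on $[s,t]$ with $\alpha,\beta\ge1$ and $\frac1\alpha+\frac1\beta>1$. -/

import Mathlib

open scoped TensorProduct ENNReal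

namespace RoughIto

/-! Partitions, Riemann sums and finite variation -/

/-- A finite partition `a = pts 0 ≤ pts 1 ≤ ... ≤ pts n = b` of `[a, b]`. (Only `pts 0, ..., pts n`
matter; repeated points contribute nothing to the sums below.) -/
structure Partition (a b : ℝ) where
  n : ℕ
  pts : ℕ → ℝ
  mono : Monotone pts
  left : pts 0 = a
  right : pts n = b

/-- The sum `∑ |g (t_{l-1}, t_l)|^r` over the intervals of a partition. -/
noncomputable def Partition.varSum {G : Type*} [NormedAddCommGroup G] {a b : ℝ}
    (D : Partition a b) (r : ℝ) (g : ℝ → ℝ → G) : ℝ :=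
  ∑ i ∈ Finset.range D.n, ‖g (D.pts i) (D.pts (i + 1))‖ ^ r

/-- `sup_D ∑ |g (t_{l-1}, t_l)|^r` over all finite partitions `D` of `[a, b]`. -/
noncomputable def variation {G : Type*} [NormedAddCommGroup G]
    (r : ℝ) (g : ℝ → ℝ → G) (a b : ℝ) : ℝ≥0∞ :=
  ⨆ D : Partition a b, ENNReal.ofReal (D.varSum r g)

/-- The additive two-parameter function `(s, t) ↦ z t - z s` of a path `z`. -/
def increment {G : Type*} [AddGroup G] (z : ℝ → G) (s t : ℝ) : G := z t - z s

/-- `I` is the Riemann–Stieltjes integral `∫_a^b Y dZ` of an operator-valued integrand: for every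
choice of tags, the sums `∑ Y (ξ_l) (Z (t_l) - Z (t_{l-1}))` tend to `I` as the mesh tends to `0`. -/
def HasStieltjesIntegral {G H : Type*} [NormedAddCommGroup G] [NormedSpace ℝ G]
    [NormedAddCommGroup H] [NormedSpace ℝ H]
    (Y : ℝ → G →L[ℝ] H) (Z : ℝ → G) (a b : ℝ) (I : H) : Prop :=
  ∀ ε > 0, ∃ δ > 0, ∀ (D : Partition a b) (ξ : ℕ → ℝ),
    (∀ i < D.n, D.pts (i + 1) - D.pts i < δ) →
    (∀ i < D.n, ξ i ∈ Set.Icc (D.pts i) (D.pts (i + 1))) →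
    ‖(∑ i ∈ Finset.range D.n, Y (ξ i) (increment Z (D.pts i) (D.pts (i + 1)))) - I‖ < ε

/-- `∫_a^b Y dZ` exists as a Young integral: `Y` and `Z` have finite variations of complementary
orders on `[a, b]` and the Riemann–Stieltjes sums converge. -/
def YoungIntegrable {G H : Type*} [NormedAddCommGroup G] [NormedSpace ℝ G]
    [NormedAddCommGroup H] [NormedSpace ℝ H]
    (Y : ℝ → G →L[ℝ] H) (Z : ℝ → G) (a b : ℝ) : Prop :=
  (∃ α β : ℝ, 1 ≤ α ∧ 1 ≤ β ∧ 1 < 1 / α + 1 / β ∧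
    variation α (increment Y) a b ≠ ∞ ∧ variation β (increment Z) a b ≠ ∞) ∧
  ∃ I : H, HasStieltjesIntegral Y Z a b I

open Classical in
/-- The Young integral `∫_a^b Y dZ` (`0` if the sums do not converge). -/
noncomputable def youngIntegral {G H : Type*} [NormedAddCommGroup G] [NormedSpace ℝ G]
    [NormedAddCommGroup H] [NormedSpace ℝ H]
    (Y : ℝ → G →L[ℝ] H) (Z : ℝ → G) (a b : ℝ) : H :=
  if h : ∃ I : H, HasStieltjesIntegral Y Z a b I then h.choose else 0

/-! Rough paths with two levels -/

section Rough

variable {V W : Type*} [NormedAddCommGroup V] [InnerProductSpace ℝ V]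
  [NormedAddCommGroup W] [InnerProductSpace ℝ W]

/-- A two-parameter function `(s, t) ↦ (1, X¹_{s,t}, X²_{s,t})` with values in `T^{(2)}(V)`; only its
values for `0 ≤ s ≤ t ≤ T` matter. -/
structure TwoLevel (V : Type*) [NormedAddCommGroup V] [InnerProductSpace ℝ V] where
  fst : ℝ → ℝ → V
  snd : ℝ → ℝ → V ⊗[ℝ] V

/-- The path `X_t = X¹_{0,t}`. -/
def TwoLevel.path (X : TwoLevel V) (t : ℝ) : V := X.fst 0 t

/-- The simplex `{(s, t) : 0 ≤ s ≤ t ≤ T}`. -/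
def simplex (T : ℝ) : Set (ℝ × ℝ) := {z | 0 ≤ z.1 ∧ z.1 ≤ z.2 ∧ z.2 ≤ T}

/-- `X` is a `p`-rough path over `[0, T]` (for `2 ≤ p < 3`): it is continuous, satisfies Chen's
identity and has finite `p`-variation. -/
structure IsRoughPath (p T : ℝ) (X : TwoLevel V) : Prop where
  continuousOn_fst : ContinuousOn (fun z : ℝ × ℝ => X.fst z.1 z.2) (simplex T)
  continuousOn_snd : ContinuousOn (fun z : ℝ × ℝ => X.snd z.1 z.2) (simplex T)
  chen_fst : ∀ s u t : ℝ, 0 ≤ s → s ≤ u → u ≤ t → t ≤ T →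
    X.fst s t = X.fst s u + X.fst u t
  chen_snd : ∀ s u t : ℝ, 0 ≤ s → s ≤ u → u ≤ t → t ≤ T →
    X.snd s t = X.snd s u + X.snd u t + X.fst s u ⊗ₜ[ℝ] X.fst u t
  variation_fst : variation p X.fst 0 T ≠ ∞
  variation_snd : variation (p / 2) X.snd 0 T ≠ ∞

/-- The `p`-variation distance `d_p`. -/
noncomputable def pVarDist (p T : ℝ) (X Y : TwoLevel V) : ℝ≥0∞ :=
  variation p (fun s t => X.fst s t - Y.fst s t) 0 T ^ (1 / p) +
    variation (p / 2) (fun s t => X.snd s t - Y.snd s t) 0 T ^ (2 / p)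

/-- `X` is the canonical lift of the continuous path `x` of bounded variation:
`X¹_{s,t} = x_t - x_s` and `X²_{s,t} = ∫_{s<t₁<t₂<t} dx_{t₁} ⊗ dx_{t₂} = ∫_s^t (x_u - x_s) ⊗ dx_u`. -/
structure IsCanonicalLift (T : ℝ) (x : ℝ → V) (X : TwoLevel V) : Prop where
  continuousOn : ContinuousOn x (Set.Icc 0 T)
  boundedVariation : BoundedVariationOn x (Set.Icc 0 T)
  fst_eq : ∀ s t : ℝ, 0 ≤ s → s ≤ t → t ≤ T → X.fst s t = x t - x s
  snd_eq : ∀ s t : ℝ, 0 ≤ s → s ≤ t → t ≤ T →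
    HasStieltjesIntegral (fun u => TensorProduct.mkL ℝ V V (x u - x s)) x s t (X.snd s t)

/-- `X` is a geometric `p`-rough path: a `p`-rough path that is a `d_p`-limit of canonical lifts of
continuous paths of bounded variation. -/
def IsGeometric (p T : ℝ) (X : TwoLevel V) : Prop :=
  IsRoughPath p T X ∧ ∃ (x : ℕ → ℝ → V) (Xn : ℕ → TwoLevel V),
    (∀ n, IsCanonicalLift T (x n) (Xn n)) ∧
    Filter.Tendsto (fun n => pVarDist p T (Xn n) X) Filter.atTop (nhds 0)

/-- The perturbation `X(φ) = (1, X¹_{s,t}, X²_{s,t} - (φ_t - φ_s))`. -/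
def TwoLevel.perturb (X : TwoLevel V) (φ : ℝ → V ⊗[ℝ] V) : TwoLevel V where
  fst := X.fst
  snd := fun s t => X.snd s t - increment φ s t

/-- A control: non-negative, continuous, super-additive on the simplex, zero on the diagonal. -/
structure IsControl (T : ℝ) (ω : ℝ → ℝ → ℝ) : Prop where
  nonneg : ∀ s t : ℝ, 0 ≤ s → s ≤ t → t ≤ T → 0 ≤ ω s t
  continuousOn : ContinuousOn (fun z : ℝ × ℝ => ω z.1 z.2) (simplex T)
  superadditive : ∀ s u t : ℝ, 0 ≤ s → s ≤ u → u ≤ t → t ≤ T → ω s u + ω u t ≤ ω s t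
  diag : ∀ t : ℝ, 0 ≤ t → t ≤ T → ω t t = 0

/-! Rough integrals of one-forms -/

/-- The linear map `V ⊗ V → W`, `ξ ⊗ η ↦ B ξ η`, of a bilinear map `B`. -/
noncomputable def tensorLift [FiniteDimensional ℝ V] (B : V →L[ℝ] V →L[ℝ] W) :
    V ⊗[ℝ] V →L[ℝ] W :=
  LinearMap.toContinuousLinearMap (TensorProduct.lift B.toLinearMap₁₂)

/-- The linear map `A ⊗ A : V ⊗ V → W ⊗ W`, `ξ ⊗ η ↦ A ξ ⊗ A η`. -/
noncomputable def tensorSq [FiniteDimensional ℝ V] (A : V →L[ℝ] W) :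
    V ⊗[ℝ] V →L[ℝ] W ⊗[ℝ] W :=
  LinearMap.toContinuousLinearMap (TensorProduct.map A.toLinearMap A.toLinearMap)

/-- The almost rough path of the one-form `f` along `X`:
`(f(X_s) X¹_{s,t} + Df(X_s) X²_{s,t}, (f(X_s) ⊗ f(X_s)) X²_{s,t})`. -/
noncomputable def almostIntegral [FiniteDimensional ℝ V] (f : V → V →L[ℝ] W) (X : TwoLevel V) :
    TwoLevel W where
  fst := fun s t => f (X.path s) (X.fst s t) + tensorLift (fderiv ℝ f (X.path s)) (X.snd s t)
  snd := fun s t => tensorSq (f (X.path s)) (X.snd s t)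

/-- `Y` is the rough integral `∫ f(X) dX`: it is the rough path associated with the almost rough path
of `f` along `X`, that is, the two differ by at most `ω(s,t)^θ` for a control `ω` and a `θ > 1`. -/
def IsRoughIntegral [FiniteDimensional ℝ V] (p T : ℝ) (f : V → V →L[ℝ] W) (X : TwoLevel V)
    (Y : TwoLevel W) : Prop :=
  IsRoughPath p T Y ∧ ∃ (ω : ℝ → ℝ → ℝ) (θ : ℝ), IsControl T ω ∧ 1 < θ ∧
    ∀ s t : ℝ, 0 ≤ s → s ≤ t → t ≤ T →
      ‖Y.fst s t - (almostIntegral f X).fst s t‖ ≤ ω s t ^ θ ∧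
      ‖Y.snd s t - (almostIntegral f X).snd s t‖ ≤ ω s t ^ θ

open Classical in
/-- The rough integral `∫ f(X) dX` (zero if there is none). -/
noncomputable def roughIntegral [FiniteDimensional ℝ V] (p T : ℝ) (f : V → V →L[ℝ] W)
    (X : TwoLevel V) : TwoLevel W :=
  if h : ∃ Y : TwoLevel W, IsRoughIntegral p T f X Y then h.choose else ⟨fun _ _ => 0, fun _ _ => 0⟩

/-- The image `F_R(X) = ∫ DF(X) dX` of a rough path under a function `F`. -/
noncomputable def image [FiniteDimensional ℝ V] (p T : ℝ) (F : V → W) (X : TwoLevel V) :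
    TwoLevel W :=
  roughIntegral p T (fderiv ℝ F) X

/-- `D²F(x)` as a linear map `V ⊗ V → W`. -/
noncomputable def hess [FiniteDimensional ℝ V] (F : V → W) (x : V) : V ⊗[ℝ] V →L[ℝ] W :=
  tensorLift (fderiv ℝ (fderiv ℝ F) x)

/-- `F` is `Lip(γ)` in the sense of Stein: with `k` the integer such that `k < γ ≤ k + 1`, `F` is `k`
times continuously differentiable, `F` and its derivatives of order at most `k` are bounded, and the
`k`-th derivative is Hölder continuous of exponent `γ - k`. -/
def IsLip (γ : ℝ) (F : V → W) : Prop :=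
  ∃ (k : ℕ) (M : ℝ), (k : ℝ) < γ ∧ γ ≤ k + 1 ∧ ContDiff ℝ k F ∧
    (∀ j ≤ k, ∀ x, ‖iteratedFDeriv ℝ j F x‖ ≤ M) ∧
    ∀ x y, ‖iteratedFDeriv ℝ k F x - iteratedFDeriv ℝ k F y‖ ≤ M * ‖x - y‖ ^ (γ - k)

end Rough

end RoughIto

/-!
The formula rests on two observations. The rough integral of `DF` along a geometric rough path `X`
has first level `F(X_t) - F(X_s)`, since geometricity makes the symmetric part of `X²` equal to
half the square of `X¹`, so that the defining germ `DF(X_s) X¹ + D²F(X_s) X²` is Taylor's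
polynomial (`IsGeometric.tensorLift_snd`, `norm_taylor_two_le`). And the perturbation `φ` is
regular enough for all its integrals to be Young integrals, so the integral along `X(φ)` can be
written down instead of constructed: with `f = F(X)` and `J = ∫ D²F(X) dφ`, its first level is the
increment of `f - J`, and its second level is `N_t - N_s - (f - J)_s ⊗ ((f - J)_t - (f - J)_s)`
for a path `N` that is the corresponding path `N₀` for `X`, corrected by Young integrals. Chen's
identity is automatic for such an expression (`TwoLevel.ofPaths`); expanding the product gives the
mixed integrals of the formula. It remains to compare with the germs, and the rough integral is
unique (`IsRoughIntegral.unique`).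

All estimates are stated as orders with respect to one *additive* control. The variation of a
continuous two-parameter function `g`, taken over `[0, t]`, is a continuous function `τ` of `t`,
and `‖g s t‖ ^ r ≤ τ t - τ s` (`exists_clock`). Continuity holds because the variation is the
least superadditive majorant of `‖g‖ ^ r`, and a majorant with a jump could be lowered. Thus `X¹ =
O(ρ ^ (1/p))` and `X², φ = O(ρ ^ (2/p))` with `ρ = τ t - τ s`, and the increments of `D²F(X)` are
`O(ρ ^ (κ/p))` with `κ = min γ 3 - 2`; the hypotheses `p < γ` and `p < 3` say precisely that the
exponent `(κ + 2)/p` exceeds `1`. The sewing lemma (`exists_sewing`) then yields both the path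
`N₀` and the Young integrals (`exists_young`).
-/

namespace RoughIto

open Set Filter Topology

/-! ### Partitions and variation -/

section Variation

variable {G : Type*} [NormedAddCommGroup G]

lemma Partition.mem_Icc {a b : ℝ} (D : Partition a b) {i : ℕ} (hi : i ≤ D.n) :
    D.pts i ∈ Icc a b :=
  ⟨by simpa only [D.left] using D.mono (Nat.zero_le i), by simpa only [D.right] using D.mono hi⟩

lemma Partition.le {a b : ℝ} (D : Partition a b) : a ≤ b :=
  (D.mem_Icc (Nat.zero_le _)).1.trans (D.mem_Icc (Nat.zero_le _)).2

lemma Partition.sum_le_of_superadditive {a b : ℝ} (D : Partition a b) {w h : ℝ → ℝ → ℝ}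
    (hw : ∀ u v y, a ≤ u → u ≤ v → v ≤ y → y ≤ b → w u v + w v y ≤ w u y)
    (h0 : 0 ≤ w a a) (hh : ∀ u v, a ≤ u → u ≤ v → v ≤ b → h u v ≤ w u v) :
    ∑ i ∈ Finset.range D.n, h (D.pts i) (D.pts (i + 1)) ≤ w a b := by
  have key : ∀ k ≤ D.n, ∑ i ∈ Finset.range k, h (D.pts i) (D.pts (i + 1)) ≤ w a (D.pts k) := by
    intro k
    induction k with
    | zero => intro _; simpa [D.left] using h0
    | succ k ih =>
      intro hk
      have h1 := D.mem_Icc (Nat.le_of_succ_le hk)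
      have h2 := D.mem_Icc hk
      have hm := D.mono (Nat.le_succ k)
      rw [Finset.sum_range_succ]
      linarith [ih (Nat.le_of_succ_le hk), hh _ _ h1.1 hm h2.2, hw a _ _ le_rfl h1.1 hm h2.2]
  simpa only [D.right] using key D.n le_rfl

/-- The partition of `[a, b]` with the points `a, b` only. -/
def Partition.pair {a b : ℝ} (h : a ≤ b) : Partition a b where
  n := 1
  pts := fun i => if i = 0 then a else b
  mono := monotone_nat_of_le_succ fun n => by rcases n with _ | n <;> simp [h]
  left := by simp
  right := by simp

/-- The concatenation of a partition of `[a, b]` and a partition of `[b, c]`. -/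
def Partition.append {a b c : ℝ} (D : Partition a b) (E : Partition b c) : Partition a c where
  n := D.n + E.n
  pts := fun i => if i ≤ D.n then D.pts i else E.pts (i - D.n)
  mono := by
    intro i j hij
    dsimp only
    split_ifs with h1 h2 h2
    · exact D.mono hij
    · exact (D.mem_Icc h1).2.trans (by simpa only [E.left] using E.mono (Nat.zero_le (j - D.n)))
    · omega
    · exact E.mono (by omega)
  left := by simp [D.left]
  right := by
    rcases Nat.eq_zero_or_pos E.n with h | h
    · have h1 := E.right
      rw [h, E.left] at h1
      simp [h, D.right, h1]
    · rw [if_neg (by omega)]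
      simp [E.right]

lemma Partition.sum_append {a b c : ℝ} (D : Partition a b) (E : Partition b c) (h : ℝ → ℝ → ℝ) :
    ∑ i ∈ Finset.range (D.append E).n, h ((D.append E).pts i) ((D.append E).pts (i + 1)) =
      ∑ i ∈ Finset.range D.n, h (D.pts i) (D.pts (i + 1)) +
        ∑ i ∈ Finset.range E.n, h (E.pts i) (E.pts (i + 1)) := by
  have hn : (D.append E).n = D.n + E.n := rfl
  rw [hn, Finset.sum_range_add]
  congr 1
  · refine Finset.sum_congr rfl fun i hi => ?_
    have := Finset.mem_range.1 hi
    simp only [Partition.append]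
    rw [if_pos (by omega), if_pos (by omega)]
  · refine Finset.sum_congr rfl fun i hi => ?_
    have e1 : (D.append E).pts (D.n + i) = E.pts i := by
      rcases Nat.eq_zero_or_pos i with h0 | h0
      · simp [Partition.append, h0, D.right, E.left]
      · simp only [Partition.append]
        rw [if_neg (by omega), Nat.add_sub_cancel_left]
    have e2 : (D.append E).pts (D.n + i + 1) = E.pts (i + 1) := by
      simp only [Partition.append]
      rw [if_neg (by omega), Nat.add_assoc, Nat.add_sub_cancel_left]
    rw [e1, e2]

lemma Partition.varSum_nonneg {a b : ℝ} (D : Partition a b) (r : ℝ) (g : ℝ → ℝ → G) :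
    0 ≤ D.varSum r g :=
  Finset.sum_nonneg fun _ _ => Real.rpow_nonneg (norm_nonneg _) _

lemma ofReal_norm_rpow_le_variation {a b : ℝ} (hab : a ≤ b) (r : ℝ) (g : ℝ → ℝ → G) :
    ENNReal.ofReal (‖g a b‖ ^ r) ≤ variation r g a b := by
  refine le_trans (le_of_eq ?_)
    (le_iSup (fun D : Partition a b => ENNReal.ofReal (D.varSum r g)) (Partition.pair hab))
  simp [Partition.varSum, Partition.pair]

lemma variation_add_le {a b c : ℝ} (hab : a ≤ b) (hbc : b ≤ c) (r : ℝ) (g : ℝ → ℝ → G) :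
    variation r g a b + variation r g b c ≤ variation r g a c := by
  have : Nonempty (Partition a b) := ⟨Partition.pair hab⟩
  have : Nonempty (Partition b c) := ⟨Partition.pair hbc⟩
  refine ENNReal.iSup_add_iSup_le fun D E => ?_
  rw [← ENNReal.ofReal_add (D.varSum_nonneg r g) (E.varSum_nonneg r g)]
  refine le_trans (le_of_eq ?_)
    (le_iSup (fun D : Partition a c => ENNReal.ofReal (D.varSum r g)) (D.append E))
  unfold Partition.varSum
  rw [D.sum_append E fun s t => ‖g s t‖ ^ r]

lemma variation_mono {a b a' b' : ℝ} (ha : a ≤ a') (hab : a' ≤ b') (hb : b' ≤ b) (r : ℝ)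
    (g : ℝ → ℝ → G) : variation r g a' b' ≤ variation r g a b :=
  calc variation r g a' b' ≤ variation r g a' b' + variation r g b' b := le_self_add
    _ ≤ variation r g a' b := variation_add_le hab hb r g
    _ ≤ variation r g a a' + variation r g a' b := le_add_self
    _ ≤ variation r g a b := variation_add_le ha (hab.trans hb) r g

/-- The variation is the least superadditive function that dominates `‖g‖ ^ r`. -/
lemma variation_le_of_superadditive {a b r : ℝ} {g : ℝ → ℝ → G} {w : ℝ → ℝ → ℝ}
    (hw : ∀ u v y, a ≤ u → u ≤ v → v ≤ y → y ≤ b → w u v + w v y ≤ w u y)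
    (h0 : 0 ≤ w a a) (hh : ∀ u v, a ≤ u → u ≤ v → v ≤ b → ‖g u v‖ ^ r ≤ w u v) :
    variation r g a b ≤ ENNReal.ofReal (w a b) :=
  iSup_le fun D => ENNReal.ofReal_le_ofReal
    (D.sum_le_of_superadditive (h := fun s t => ‖g s t‖ ^ r) hw h0 hh)

lemma variation_congr {a b r : ℝ} {g g' : ℝ → ℝ → G}
    (h : ∀ u v, a ≤ u → u ≤ v → v ≤ b → g u v = g' u v) :
    variation r g a b = variation r g' a b := by
  refine iSup_congr fun D => congrArg _ (Finset.sum_congr rfl fun i hi => ?_)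
  have hi := Finset.mem_range.1 hi
  rw [h _ _ (D.mem_Icc hi.le).1 (D.mono (Nat.le_succ i)) (D.mem_Icc hi).2]

/-- A continuous time change of `[0, T]`. Its increments `τ t - τ s` serve as a control that is not
only superadditive but additive. -/
structure IsClock (T : ℝ) (τ : ℝ → ℝ) : Prop where
  monotoneOn : MonotoneOn τ (Icc 0 T)
  continuousOn : ContinuousOn τ (Icc 0 T)

lemma IsClock.sub_nonneg {T : ℝ} {τ : ℝ → ℝ} (h : IsClock T τ) {s t : ℝ} (hs : 0 ≤ s)
    (hst : s ≤ t) (ht : t ≤ T) : 0 ≤ τ t - τ s :=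
  _root_.sub_nonneg.2 (h.monotoneOn ⟨hs, hst.trans ht⟩ ⟨hs.trans hst, ht⟩ hst)

lemma IsClock.add {T : ℝ} {τ σ : ℝ → ℝ} (h : IsClock T τ) (h' : IsClock T σ) :
    IsClock T (fun t => τ t + σ t) :=
  ⟨h.monotoneOn.add h'.monotoneOn, h.continuousOn.add h'.continuousOn⟩

/-- The smallness of the least superadditive majorant `V` of `h` on short intervals `[t, b]`: if
`V t b > η` for all `b > t`, then lowering `V t b` by `η / 2` for all `b > t` leaves a superadditive
majorant of `h`. -/
lemma exists_small_right {T : ℝ} {h V : ℝ → ℝ → ℝ}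
    (hc : ContinuousOn (fun z : ℝ × ℝ => h z.1 z.2) (simplex T))
    (hd : ∀ t, 0 ≤ t → t ≤ T → h t t = 0)
    (hsup : ∀ u v y, 0 ≤ u → u ≤ v → v ≤ y → y ≤ T → V u v + V v y ≤ V u y)
    (hV : ∀ u v, 0 ≤ u → u ≤ v → v ≤ T → 0 ≤ V u v)
    (hle : ∀ u v, 0 ≤ u → u ≤ v → v ≤ T → h u v ≤ V u v)
    (hmin : ∀ a b, 0 ≤ a → a ≤ b → b ≤ T → ∀ w : ℝ → ℝ → ℝ,
      (∀ u v y, a ≤ u → u ≤ v → v ≤ y → y ≤ b → w u v + w v y ≤ w u y) → 0 ≤ w a a →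
      (∀ u v, a ≤ u → u ≤ v → v ≤ b → h u v ≤ w u v) → V a b ≤ w a b)
    {t : ℝ} (ht : 0 ≤ t) {η : ℝ} (hη : 0 < η) :
    ∃ δ > 0, ∀ b, t ≤ b → b ≤ T → b < t + δ → V t b ≤ η := by
  by_contra! hcon
  have hbig : ∀ b, t < b → b ≤ T → η < V t b := by
    intro b hb hbT
    obtain ⟨c, hc1, hc2, hc3, hc4⟩ := hcon (b - t) (by linarith)
    have := hsup t c b ht hc1 (by linarith) hbT
    have := hV c b (by linarith) (by linarith) hbT
    linarith
  obtain ⟨b₀, hb₀, hb₀T, -, -⟩ := hcon 1 one_pos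
  have htT : t ≤ T := hb₀.trans hb₀T
  have hct := hc (t, t) ⟨ht, le_rfl, htT⟩
  rw [Metric.continuousWithinAt_iff] at hct
  obtain ⟨δ, hδ, hδ'⟩ := hct (η / 2) (half_pos hη)
  have hsm : ∀ v, t ≤ v → v ≤ T → v < t + δ → h t v ≤ η / 2 := by
    intro v hv hvT hvd
    have := @hδ' (t, v) ⟨ht, hv, hvT⟩ (by
      rw [Prod.dist_eq, dist_self, Real.dist_eq, abs_of_nonneg (by linarith : 0 ≤ v - t)]
      exact max_lt hδ (by linarith))
    simp only [hd t ht htT, Real.dist_eq, sub_zero] at this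
    exact ((le_abs_self _).trans_lt this).le
  obtain ⟨c, hc1, hc2, hc3, hc4⟩ := hcon δ hδ
  have htc : t < c := by
    rcases hc1.lt_or_eq with h | h
    · exact h
    · subst h
      linarith [hsup t t t ht le_rfl le_rfl htT]
  classical
  have := hmin t c ht hc1 hc2
    (fun a b => if t < a then V a b else if t < b then V t b - η / 2 else 0) (by
      intro u v y hu huv hvy hyc
      rcases hu.lt_or_eq with hu | rfl
      · simp only [if_pos hu, if_pos (hu.trans_le huv)]
        exact hsup u v y (by linarith) huv hvy (by linarith)
      · rcases huv.lt_or_eq with huv' | rfl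
        · simp only [lt_irrefl, if_false, if_pos huv', if_pos (huv'.trans_le hvy)]
          linarith [hsup t v y ht huv hvy (by linarith)]
        · simp only [lt_irrefl, if_false]
          linarith) (by simp) (by
      intro u v hu huv hvc
      rcases hu.lt_or_eq with hu | rfl
      · simp only [if_pos hu]
        exact hle u v (by linarith) huv (by linarith)
      · rcases huv.lt_or_eq with huv' | rfl
        · simp only [lt_irrefl, if_false, if_pos huv']
          linarith [hsm v huv (by linarith) (by linarith), hbig v huv' (by linarith)]
        · simp [hd t ht htT])
  simp only [lt_irrefl, if_false, if_pos htc] at this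
  linarith

/-- The mirror image of `exists_small_right`. -/
lemma exists_small_left {T : ℝ} {h V : ℝ → ℝ → ℝ}
    (hc : ContinuousOn (fun z : ℝ × ℝ => h z.1 z.2) (simplex T))
    (hd : ∀ t, 0 ≤ t → t ≤ T → h t t = 0)
    (hsup : ∀ u v y, 0 ≤ u → u ≤ v → v ≤ y → y ≤ T → V u v + V v y ≤ V u y)
    (hV : ∀ u v, 0 ≤ u → u ≤ v → v ≤ T → 0 ≤ V u v)
    (hle : ∀ u v, 0 ≤ u → u ≤ v → v ≤ T → h u v ≤ V u v)
    (hmin : ∀ a b, 0 ≤ a → a ≤ b → b ≤ T → ∀ w : ℝ → ℝ → ℝ,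
      (∀ u v y, a ≤ u → u ≤ v → v ≤ y → y ≤ b → w u v + w v y ≤ w u y) → 0 ≤ w a a →
      (∀ u v, a ≤ u → u ≤ v → v ≤ b → h u v ≤ w u v) → V a b ≤ w a b)
    {t : ℝ} (ht : t ≤ T) {η : ℝ} (hη : 0 < η) :
    ∃ δ > 0, ∀ a, 0 ≤ a → a ≤ t → t < a + δ → V a t ≤ η := by
  have := exists_small_right (T := T) (h := fun a b => h (T - b) (T - a))
    (V := fun a b => V (T - b) (T - a))
    (hc.comp (f := fun z : ℝ × ℝ => (T - z.2, T - z.1)) (by fun_prop)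
      fun z hz => ⟨by linarith [hz.2.2], by linarith [hz.2.1], by linarith [hz.1]⟩)
    (fun t h1 h2 => hd _ (by linarith) (by linarith))
    (fun u v y h1 h2 h3 h4 => by
      have := hsup (T - y) (T - v) (T - u) (by linarith) (by linarith) (by linarith) (by linarith)
      linarith)
    (fun u v h1 h2 h3 => hV _ _ (by linarith) (by linarith) (by linarith))
    (fun u v h1 h2 h3 => hle _ _ (by linarith) (by linarith) (by linarith))
    (fun a b h1 h2 h3 w hw hw0 hhw => by
      have := hmin (T - b) (T - a) (by linarith) (by linarith) (by linarith)
        (fun u v => w (T - v) (T - u))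
        (fun u v y g1 g2 g3 g4 => by
          have := hw (T - y) (T - v) (T - u) (by linarith) (by linarith) (by linarith)
            (by linarith)
          linarith)
        (by
          have h5 := hw a b b le_rfl h2 le_rfl le_rfl
          have h6 := hhw b b h2 le_rfl le_rfl
          simp only [hd (T - b) (by linarith) (by linarith)] at h6
          simpa using h6)
        (fun u v g1 g2 g3 => by
          have := hhw (T - v) (T - u) (by linarith) (by linarith) (by linarith)
          simpa using this)
      simpa using this)
    (t := T - t) (by linarith) hη
  obtain ⟨δ, hδ, H⟩ := this
  refine ⟨δ, hδ, fun a ha hat hta => ?_⟩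
  simpa using H (T - a) (by linarith) (by linarith) (by linarith)

/-- The least superadditive majorant `V` of a continuous function `h` is continuous in its right
end point. -/
lemma continuousOn_least_superadditive {T : ℝ} {h V : ℝ → ℝ → ℝ}
    (hc : ContinuousOn (fun z : ℝ × ℝ => h z.1 z.2) (simplex T))
    (hd : ∀ t, 0 ≤ t → t ≤ T → h t t = 0)
    (hsup : ∀ u v y, 0 ≤ u → u ≤ v → v ≤ y → y ≤ T → V u v + V v y ≤ V u y)
    (hV : ∀ u v, 0 ≤ u → u ≤ v → v ≤ T → 0 ≤ V u v)
    (hle : ∀ u v, 0 ≤ u → u ≤ v → v ≤ T → h u v ≤ V u v)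
    (hmin : ∀ a b, 0 ≤ a → a ≤ b → b ≤ T → ∀ w : ℝ → ℝ → ℝ,
      (∀ u v y, a ≤ u → u ≤ v → v ≤ y → y ≤ b → w u v + w v y ≤ w u y) → 0 ≤ w a a →
      (∀ u v, a ≤ u → u ≤ v → v ≤ b → h u v ≤ w u v) → V a b ≤ w a b) :
    ContinuousOn (V 0) (Icc 0 T) := by
  have hcomp : IsCompact (simplex T) := by
    refine (isCompact_Icc.prod isCompact_Icc : IsCompact (Icc 0 T ×ˢ Icc 0 T)).of_isClosed_subset
      ?_ fun z hz => ⟨⟨hz.1, hz.2.1.trans hz.2.2⟩, ⟨hz.1.trans hz.2.1, hz.2.2⟩⟩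
    exact (isClosed_le continuous_const continuous_fst).inter
      ((isClosed_le continuous_fst continuous_snd).inter
        (isClosed_le continuous_snd continuous_const))
  have huc := hcomp.uniformContinuousOn_of_continuous hc
  rw [Metric.uniformContinuousOn_iff] at huc
  -- Enlarging an interval from `[0, t]` to `[0, t']` costs little more than `V t t'`.
  have hext : ∀ η > 0, ∃ δ > 0, ∀ t t', 0 ≤ t → t ≤ t' → t' ≤ T → t' < t + δ →
      V 0 t' ≤ V 0 t + η + V t t' := by
    intro η hη
    obtain ⟨δ, hδ, H⟩ := huc η hη
    refine ⟨δ, hδ, fun t t' h0 htt' htT hd' => ?_⟩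
    rcases h0.lt_or_eq with h0' | rfl
    swap
    · linarith [hV 0 0 le_rfl le_rfl (by linarith)]
    rcases htt'.lt_or_eq with htt'' | rfl
    swap
    · linarith [hV t t h0 le_rfl htT]
    classical
    have := hmin 0 t' le_rfl (by linarith) htT
      (fun a b => if a < t ∧ t < b then V a t + η + V t b else V a b) (by
        intro u v y hu huv hvy hyt
        have s1 := hsup u v y hu huv hvy (by linarith)
        by_cases h1 : u < t <;> by_cases h2 : t < y
        · rw [if_pos (⟨h1, h2⟩ : u < t ∧ t < y)]
          rcases lt_trichotomy v t with h3 | h3 | h3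
          · rw [if_neg (by intro h; linarith [h.2]), if_pos ⟨h3, h2⟩]
            linarith [hsup u v t hu huv h3.le (by linarith)]
          · subst h3
            rw [if_neg (by intro h; linarith [h.2]), if_neg (by intro h; linarith [h.1])]
            linarith
          · rw [if_pos ⟨h1, h3⟩, if_neg (by intro h; linarith [h.1])]
            linarith [hsup t v y h0 h3.le hvy (by linarith)]
        all_goals
          rw [if_neg (by intro h; linarith [h.1, h.2]), if_neg (by intro h; linarith [h.1, h.2]),
            if_neg (by intro h; linarith [h.1, h.2])]
          exact s1)
      (by rw [if_neg (by intro h; linarith [h.2])]; exact hV 0 0 le_rfl le_rfl (by linarith))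
      (by
        intro u v hu huv hvt
        split_ifs with h1
        · have e := H (u, v) ⟨hu, huv, by linarith⟩ (u, t) ⟨hu, h1.1.le, by linarith⟩ (by
            rw [Prod.dist_eq, dist_self, Real.dist_eq, abs_of_nonneg (by linarith [h1.2])]
            exact max_lt hδ (by linarith [h1.2]))
          rw [Real.dist_eq] at e
          have := (le_abs_self _).trans_lt e
          simp only at this
          linarith [hle u t hu h1.1.le (by linarith), hV t v h0 h1.2.le (by linarith)]
        · exact hle u v hu huv (by linarith))
    simpa only [if_pos (⟨h0', htt''⟩ : 0 < t ∧ t < t')] using this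
  intro t ht
  rw [Metric.continuousWithinAt_iff]
  intro ε hε
  obtain ⟨δ₁, hδ₁, H₁⟩ := hext (ε / 3) (by linarith)
  obtain ⟨δ₂, hδ₂, H₂⟩ := exists_small_right hc hd hsup hV hle hmin ht.1
    (show 0 < ε / 3 by linarith)
  obtain ⟨δ₃, hδ₃, H₃⟩ := exists_small_left hc hd hsup hV hle hmin ht.2 (show 0 < ε / 3 by linarith)
  refine ⟨min δ₁ (min δ₂ δ₃), by positivity, fun {t'} ht' hdist => ?_⟩
  rw [lt_min_iff, lt_min_iff, Real.dist_eq] at hdist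
  obtain ⟨hd1, hd2, hd3⟩ := hdist
  rw [abs_lt] at hd1 hd2 hd3
  rw [Real.dist_eq, abs_lt]
  rcases le_total t t' with h | h
  · have a1 := H₁ t t' ht.1 h ht'.2 (by linarith)
    have a2 := H₂ t' h ht'.2 (by linarith)
    have a3 := hsup 0 t t' le_rfl ht.1 h ht'.2
    have a4 := hV t t' ht.1 h ht'.2
    constructor <;> linarith
  · have a1 := H₁ t' t ht'.1 h ht.2 (by linarith)
    have a2 := H₃ t' ht'.1 h (by linarith)
    have a3 := hsup 0 t' t le_rfl ht'.1 h ht.2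
    have a4 := hV t' t ht'.1 h ht.2
    constructor <;> linarith

/-- A continuous two-parameter function of finite `r`-variation is dominated by the increments of a
continuous clock, namely the variation from time `0`. -/
theorem exists_clock {T r : ℝ} (hr : 0 < r) {g : ℝ → ℝ → G}
    (hc : ContinuousOn (fun z : ℝ × ℝ => g z.1 z.2) (simplex T))
    (hd : ∀ t, 0 ≤ t → t ≤ T → g t t = 0) (hfin : variation r g 0 T ≠ ∞) :
    ∃ τ : ℝ → ℝ, IsClock T τ ∧
      ∀ s t, 0 ≤ s → s ≤ t → t ≤ T → ‖g s t‖ ^ r ≤ τ t - τ s := by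
  have hf : ∀ a b, 0 ≤ a → a ≤ b → b ≤ T → variation r g a b ≠ ∞ := fun a b h1 h2 h3 =>
    ne_top_of_le_ne_top hfin (variation_mono h1 h2 h3 r g)
  set V : ℝ → ℝ → ℝ := fun a b => (variation r g a b).toReal with hVdef
  have hsup : ∀ u v y, 0 ≤ u → u ≤ v → v ≤ y → y ≤ T → V u v + V v y ≤ V u y := by
    intro u v y h1 h2 h3 h4
    rw [hVdef]
    dsimp only
    rw [← ENNReal.toReal_add (hf _ _ h1 h2 (h3.trans h4)) (hf _ _ (h1.trans h2) h3 h4)]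
    exact ENNReal.toReal_mono (hf _ _ h1 (h2.trans h3) h4) (variation_add_le h2 h3 r g)
  have hV : ∀ u v, 0 ≤ u → u ≤ v → v ≤ T → 0 ≤ V u v := fun _ _ _ _ _ => ENNReal.toReal_nonneg
  have hle : ∀ u v, 0 ≤ u → u ≤ v → v ≤ T → ‖g u v‖ ^ r ≤ V u v := fun u v h1 h2 h3 =>
    (ENNReal.ofReal_le_iff_le_toReal (hf u v h1 h2 h3)).1 (ofReal_norm_rpow_le_variation h2 r g)
  have hcV : ContinuousOn (V 0) (Icc 0 T) := by
    refine continuousOn_least_superadditive (h := fun u v => ‖g u v‖ ^ r)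
      (hc.norm.rpow_const fun _ _ => Or.inr hr.le)
      (fun t h1 h2 => by simp [hd t h1 h2, Real.zero_rpow hr.ne']) hsup hV hle ?_
    intro a b h1 h2 h3 w hw hw0 hhw
    refine ENNReal.toReal_le_of_le_ofReal ?_ (variation_le_of_superadditive hw hw0 hhw)
    linarith [hhw a b le_rfl h2 le_rfl, Real.rpow_nonneg (norm_nonneg (g a b)) r]
  refine ⟨V 0, ⟨fun s hs t ht hst => ?_, hcV⟩, fun s t hs hst ht => ?_⟩
  · linarith [hsup 0 s t le_rfl hs.1 hst ht.2, hV s t hs.1 hst ht.2]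
  · linarith [hsup 0 s t le_rfl hs hst ht, hle s t hs hst ht]

/-- Finite variation of some order `q` gives finite variation of every larger order. -/
lemma variation_ne_top_of_le {q r T : ℝ} (hq : 0 < q) (hqr : q ≤ r) {g : ℝ → ℝ → G}
    (h : variation q g 0 T ≠ ∞) : variation r g 0 T ≠ ∞ := by
  set M := (variation q g 0 T).toReal
  have hM : 0 ≤ M := ENNReal.toReal_nonneg
  have hb : ∀ s t, 0 ≤ s → s ≤ t → t ≤ T → ‖g s t‖ ≤ M ^ (1 / q) := by
    intro s t hs hst ht
    have h1 : ‖g s t‖ ^ q ≤ M := (ENNReal.ofReal_le_iff_le_toReal h).1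
      ((ofReal_norm_rpow_le_variation hst q g).trans (variation_mono hs hst ht q g))
    calc ‖g s t‖ = (‖g s t‖ ^ q) ^ (1 / q) := by
          rw [← Real.rpow_mul (norm_nonneg _), mul_one_div_cancel hq.ne', Real.rpow_one]
      _ ≤ M ^ (1 / q) := Real.rpow_le_rpow (by positivity) h1 (by positivity)
  refine ne_top_of_le_ne_top (ENNReal.ofReal_ne_top (r := (M ^ (1 / q)) ^ (r - q) * M))
    (iSup_le fun D => ENNReal.ofReal_le_ofReal ?_)
  have h2 : D.varSum q g ≤ M := (ENNReal.ofReal_le_iff_le_toReal h).1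
    (le_iSup (fun D : Partition 0 T => ENNReal.ofReal (D.varSum q g)) D)
  refine le_trans ?_ (mul_le_mul_of_nonneg_left h2 (by positivity))
  unfold Partition.varSum
  rw [Finset.mul_sum]
  refine Finset.sum_le_sum fun i hi => ?_
  have hi := Finset.mem_range.1 hi
  rw [show r = (r - q) + q by ring, Real.rpow_add_of_nonneg (norm_nonneg _) (by linarith) hq.le,
    add_sub_cancel_right]
  gcongr
  exact hb _ _ (D.mem_Icc hi.le).1 (D.mono (Nat.le_succ i)) (D.mem_Icc hi).2

end Variation

/-! ### Functions of a given order -/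

section Order

variable {ι G H K : Type*} [NormedAddCommGroup G] [NormedAddCommGroup H] [NormedAddCommGroup K]

/-- `g = O(ρ ^ a)` on the set `S`. -/
def OfOrder (S : Set ι) (ρ : ι → ℝ) (a : ℝ) (g : ι → G) : Prop :=
  ∃ C, 0 ≤ C ∧ ∀ i ∈ S, ‖g i‖ ≤ C * ρ i ^ a

/-- A gauge on `S`: a bounded non-negative function. -/
def IsGauge (S : Set ι) (ρ : ι → ℝ) : Prop :=
  ∃ M, ∀ i ∈ S, 0 ≤ ρ i ∧ ρ i ≤ M

variable {S : Set ι} {ρ : ι → ℝ} {a b : ℝ} {g g' : ι → G}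

lemma OfOrder.congr (hg : OfOrder S ρ a g) (h : ∀ i ∈ S, g' i = g i) : OfOrder S ρ a g' := by
  obtain ⟨C, hC, h'⟩ := hg
  exact ⟨C, hC, fun i hi => by rw [h i hi]; exact h' i hi⟩

lemma OfOrder.add (hg : OfOrder S ρ a g) (hg' : OfOrder S ρ a g') :
    OfOrder S ρ a (fun i => g i + g' i) := by
  obtain ⟨C, hC, h⟩ := hg
  obtain ⟨C', hC', h'⟩ := hg'
  refine ⟨C + C', add_nonneg hC hC', fun i hi => ?_⟩
  rw [add_mul]
  exact (norm_add_le _ _).trans (add_le_add (h i hi) (h' i hi))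

lemma OfOrder.neg (hg : OfOrder S ρ a g) : OfOrder S ρ a (fun i => -g i) := by
  obtain ⟨C, hC, h⟩ := hg
  exact ⟨C, hC, fun i hi => by rw [norm_neg]; exact h i hi⟩

lemma OfOrder.sub (hg : OfOrder S ρ a g) (hg' : OfOrder S ρ a g') :
    OfOrder S ρ a (fun i => g i - g' i) := by
  simpa only [sub_eq_add_neg] using hg.add hg'.neg

lemma OfOrder.of_norm_le {k : ι → K} (hg : OfOrder S ρ a g)
    (c : ℝ) (hc : 0 ≤ c) (h : ∀ i ∈ S, ‖k i‖ ≤ c * ‖g i‖) : OfOrder S ρ a k := by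
  obtain ⟨C, hC, h'⟩ := hg
  refine ⟨c * C, mul_nonneg hc hC, fun i hi => (h i hi).trans ?_⟩
  rw [mul_assoc]
  exact mul_le_mul_of_nonneg_left (h' i hi) hc

lemma OfOrder.of_bound {C : ℝ} (h : ∀ i ∈ S, ‖g i‖ ≤ C) : OfOrder S ρ 0 g :=
  ⟨|C|, abs_nonneg C, fun i hi => by
    rw [Real.rpow_zero, mul_one]; exact (h i hi).trans (le_abs_self C)⟩

lemma OfOrder.mono (hρ : IsGauge S ρ) (ha : 0 ≤ a) (hab : a ≤ b) (hg : OfOrder S ρ b g) :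
    OfOrder S ρ a g := by
  obtain ⟨C, hC, h⟩ := hg
  obtain ⟨M, hM⟩ := hρ
  refine ⟨C * |M| ^ (b - a), by positivity, fun i hi => (h i hi).trans ?_⟩
  obtain ⟨h0, h1⟩ := hM i hi
  rw [mul_assoc]
  refine mul_le_mul_of_nonneg_left ?_ hC
  calc ρ i ^ b = ρ i ^ (b - a) * ρ i ^ a := by
        rw [← Real.rpow_add_of_nonneg h0 (by linarith) ha, sub_add_cancel]
    _ ≤ |M| ^ (b - a) * ρ i ^ a := by
        gcongr
        exact h1.trans (le_abs_self M)

/-- The power `c` of a function of order `a` is of order `a * c`. -/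
lemma OfOrder.norm_rpow (hρ : IsGauge S ρ) {c : ℝ} (hc : 0 ≤ c) (hg : OfOrder S ρ a g) :
    OfOrder S ρ (a * c) (fun i => ‖g i‖ ^ c) := by
  obtain ⟨C, hC, h⟩ := hg
  obtain ⟨M, hM⟩ := hρ
  refine ⟨C ^ c, by positivity, fun i hi => ?_⟩
  have h0 := (hM i hi).1
  rw [Real.norm_of_nonneg (by positivity), Real.rpow_mul h0,
    ← Real.mul_rpow hC (by positivity)]
  exact Real.rpow_le_rpow (norm_nonneg _) (h i hi) hc

/-- The triples `0 ≤ s ≤ u ≤ t ≤ T`. -/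
def triples (T : ℝ) : Set (ℝ × ℝ × ℝ) := {z | 0 ≤ z.1 ∧ z.1 ≤ z.2.1 ∧ z.2.1 ≤ z.2.2 ∧ z.2.2 ≤ T}

/-- The increment `τ t - τ s` of a clock, as a function of `(s, t)`. -/
def gap (τ : ℝ → ℝ) (z : ℝ × ℝ) : ℝ := τ z.2 - τ z.1

/-- The increment `τ t - τ s` of a clock, as a function of `(s, u, t)`. -/
def gap₃ (τ : ℝ → ℝ) (z : ℝ × ℝ × ℝ) : ℝ := τ z.2.2 - τ z.1

variable {T : ℝ} {τ : ℝ → ℝ}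

lemma IsClock.gap_nonneg (h : IsClock T τ) {z : ℝ × ℝ} (hz : z ∈ simplex T) : 0 ≤ gap τ z :=
  h.sub_nonneg hz.1 hz.2.1 hz.2.2

lemma IsClock.sub_le (h : IsClock T τ) {s t : ℝ} (hs : 0 ≤ s) (hst : s ≤ t) (ht : t ≤ T) :
    τ t - τ s ≤ τ T - τ 0 := by
  linarith [h.sub_nonneg le_rfl hs (hst.trans ht), h.sub_nonneg (hs.trans hst) ht le_rfl]

lemma IsClock.isGauge (h : IsClock T τ) : IsGauge (simplex T) (gap τ) :=
  ⟨τ T - τ 0, fun _ hz => ⟨h.gap_nonneg hz, h.sub_le hz.1 hz.2.1 hz.2.2⟩⟩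

lemma IsClock.isGauge₃ (h : IsClock T τ) : IsGauge (triples T) (gap₃ τ) :=
  ⟨τ T - τ 0, fun _ hz => ⟨h.sub_nonneg hz.1 (hz.2.1.trans hz.2.2.1) hz.2.2.2,
    h.sub_le hz.1 (hz.2.1.trans hz.2.2.1) hz.2.2.2⟩⟩

lemma OfOrder.restrict_left (hτ : IsClock T τ) (ha : 0 ≤ a) {g : ℝ × ℝ → G}
    (hg : OfOrder (simplex T) (gap τ) a g) :
    OfOrder (triples T) (gap₃ τ) a (fun z => g (z.1, z.2.1)) := by
  obtain ⟨C, hC, h⟩ := hg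
  refine ⟨C, hC, fun z hz => ?_⟩
  obtain ⟨h1, h2, h3, h4⟩ := hz
  have hm : (z.1, z.2.1) ∈ simplex T := ⟨h1, h2, h3.trans h4⟩
  refine (h _ hm).trans ?_
  have := hτ.gap_nonneg hm
  gcongr
  simp only [gap, gap₃]
  linarith [hτ.sub_nonneg (h1.trans h2) h3 h4]

lemma OfOrder.restrict_right (hτ : IsClock T τ) (ha : 0 ≤ a) {g : ℝ × ℝ → G}
    (hg : OfOrder (simplex T) (gap τ) a g) :
    OfOrder (triples T) (gap₃ τ) a (fun z => g (z.2.1, z.2.2)) := by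
  obtain ⟨C, hC, h⟩ := hg
  refine ⟨C, hC, fun z hz => ?_⟩
  obtain ⟨h1, h2, h3, h4⟩ := hz
  have hm : (z.2.1, z.2.2) ∈ simplex T := ⟨h1.trans h2, h3, h4⟩
  refine (h _ hm).trans ?_
  have := hτ.gap_nonneg hm
  gcongr
  simp only [gap, gap₃]
  linarith [hτ.sub_nonneg h1 h2 (h3.trans h4)]

/-- A function of order `a` has finite `1/a`-variation. -/
lemma OfOrder.variation_ne_top (hτ : IsClock T τ) {r : ℝ} (hr : 0 < r) {g : ℝ → ℝ → G}
    (hg : OfOrder (simplex T) (gap τ) (1 / r) (fun z => g z.1 z.2)) {s t : ℝ} (hs : 0 ≤ s)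
    (ht : t ≤ T) : variation r g s t ≠ ∞ := by
  obtain ⟨C, hC, h⟩ := hg
  refine ne_top_of_le_ne_top (ENNReal.ofReal_ne_top (r := C ^ r * (τ t - τ s)))
    (variation_le_of_superadditive (w := fun u v => C ^ r * (τ v - τ u))
      (fun u v y _ _ _ _ => le_of_eq (by ring)) (by simp) fun u v hu huv hv => ?_)
  have hm : (u, v) ∈ simplex T := ⟨hs.trans hu, huv, hv.trans ht⟩
  have h0 := hτ.gap_nonneg hm
  calc ‖g u v‖ ^ r ≤ (C * gap τ (u, v) ^ (1 / r)) ^ r :=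
        Real.rpow_le_rpow (norm_nonneg _) (h _ hm) hr.le
    _ = C ^ r * (τ v - τ u) := by
        rw [Real.mul_rpow hC (by positivity), ← Real.rpow_mul h0, one_div_mul_cancel hr.ne',
          Real.rpow_one]
        rfl

/-- Conversely, a function whose `r`-th power is dominated by a clock is of order `1/r`. -/
lemma OfOrder.of_rpow_le {r : ℝ} (hr : 0 < r) {g : ℝ → ℝ → G}
    (h : ∀ s t, 0 ≤ s → s ≤ t → t ≤ T → ‖g s t‖ ^ r ≤ τ t - τ s) :
    OfOrder (simplex T) (gap τ) (1 / r) (fun z => g z.1 z.2) := by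
  refine ⟨1, zero_le_one, fun z hz => ?_⟩
  rw [one_mul]
  calc ‖g z.1 z.2‖ = (‖g z.1 z.2‖ ^ r) ^ (1 / r) := by
        rw [← Real.rpow_mul (norm_nonneg _), mul_one_div_cancel hr.ne', Real.rpow_one]
    _ ≤ gap τ z ^ (1 / r) :=
        Real.rpow_le_rpow (by positivity) (h _ _ hz.1 hz.2.1 hz.2.2) (by positivity)

/-- A path whose increments are of positive order is continuous. -/
lemma OfOrder.continuousOn (hτ : IsClock T τ) (ha : 0 < a) {z : ℝ → G}
    (hz : OfOrder (simplex T) (gap τ) a (fun y => z y.2 - z y.1)) :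
    ContinuousOn z (Icc 0 T) := by
  obtain ⟨C, hC, h⟩ := hz
  intro t ht
  have hb : ∀ s ∈ Icc 0 T, ‖z s - z t‖ ≤ C * |τ s - τ t| ^ a := by
    intro s hs
    rcases le_total s t with hst | hst
    · have := h (s, t) ⟨hs.1, hst, ht.2⟩
      rw [norm_sub_rev, abs_sub_comm, abs_of_nonneg (hτ.sub_nonneg hs.1 hst ht.2)]
      exact this
    · have := h (t, s) ⟨ht.1, hst, hs.2⟩
      rw [abs_of_nonneg (hτ.sub_nonneg ht.1 hst hs.2)]
      exact this
  rw [ContinuousWithinAt, tendsto_iff_norm_sub_tendsto_zero]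
  have hlim : Tendsto (fun s => C * |τ s - τ t| ^ a) (𝓝[Icc 0 T] t) (𝓝 0) := by
    have h1 : Tendsto (fun s => |τ s - τ t|) (𝓝[Icc 0 T] t) (𝓝 0) := by
      simpa using ((hτ.continuousOn t ht).tendsto.sub_const (τ t)).abs
    simpa [Real.zero_rpow ha.ne'] using (h1.rpow_const (Or.inr ha.le)).const_mul C
  exact squeeze_zero' (Eventually.of_forall fun _ => norm_nonneg _)
    (eventually_mem_nhdsWithin.mono hb) hlim

variable [NormedSpace ℝ G] [NormedSpace ℝ H] [NormedSpace ℝ K]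

lemma OfOrder.clm (L : G →L[ℝ] H) (hg : OfOrder S ρ a g) : OfOrder S ρ a (fun i => L (g i)) :=
  hg.of_norm_le ‖L‖ (norm_nonneg _) fun i _ => L.le_opNorm (g i)

lemma OfOrder.bilin (hρ : IsGauge S ρ) (ha : 0 ≤ a) (hb : 0 ≤ b) (L : G →L[ℝ] H →L[ℝ] K)
    {k : ι → H} (hg : OfOrder S ρ a g) (hk : OfOrder S ρ b k) :
    OfOrder S ρ (a + b) (fun i => L (g i) (k i)) := by
  obtain ⟨C, hC, h⟩ := hg
  obtain ⟨C', hC', h'⟩ := hk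
  obtain ⟨M, hM⟩ := hρ
  refine ⟨‖L‖ * (C * C'), by positivity, fun i hi => (L.le_opNorm₂ _ _).trans ?_⟩
  have h0 := (hM i hi).1
  rw [Real.rpow_add_of_nonneg h0 ha hb]
  calc ‖L‖ * ‖g i‖ * ‖k i‖ ≤ ‖L‖ * (C * ρ i ^ a) * (C' * ρ i ^ b) := by
        gcongr
        exacts [h i hi, h' i hi]
    _ = ‖L‖ * (C * C') * (ρ i ^ a * ρ i ^ b) := by ring

lemma OfOrder.clm_apply (hρ : IsGauge S ρ) (ha : 0 ≤ a) (hb : 0 ≤ b)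
    {A : ι → G →L[ℝ] H} {k : ι → G} (hA : OfOrder S ρ a A) (hk : OfOrder S ρ b k) :
    OfOrder S ρ (a + b) (fun i => A i (k i)) :=
  hA.bilin hρ ha hb (ContinuousLinearMap.id ℝ (G →L[ℝ] H)) hk

end Order

/-! ### The sewing lemma -/

section Sewing

variable {T θ : ℝ} {τ : ℝ → ℝ}

/-- The sums of the `θ`-th powers of the increments of a clock are small over fine partitions. -/
lemma IsClock.exists_mesh (hτ : IsClock T τ) (hθ : 1 < θ) {ε : ℝ} (hε : 0 < ε) :
    ∃ δ > 0, ∀ a b, 0 ≤ a → b ≤ T → ∀ D : Partition a b,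
      (∀ i < D.n, D.pts (i + 1) - D.pts i < δ) →
      ∑ i ∈ Finset.range D.n, (τ (D.pts (i + 1)) - τ (D.pts i)) ^ θ < ε := by
  set M := |τ T - τ 0| + 1
  have hM : 0 < M := by positivity
  set κ := (ε / (2 * M)) ^ (1 / (θ - 1))
  have hκ : 0 < κ := by positivity
  have huc := isCompact_Icc.uniformContinuousOn_of_continuous hτ.continuousOn
  rw [Metric.uniformContinuousOn_iff] at huc
  obtain ⟨δ, hδ, H⟩ := huc κ hκ
  refine ⟨δ, hδ, fun a b ha hb D hD => ?_⟩
  have hterm : ∀ i ∈ Finset.range D.n, (τ (D.pts (i + 1)) - τ (D.pts i)) ^ θ ≤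
      ε / (2 * M) * (τ (D.pts (i + 1)) - τ (D.pts i)) := by
    intro i hi
    have hi := Finset.mem_range.1 hi
    have h1 := D.mem_Icc hi.le
    have h2 := D.mem_Icc (Nat.succ_le_of_lt hi)
    have hm := D.mono (Nat.le_succ i)
    have h0 := hτ.sub_nonneg (ha.trans h1.1) hm (h2.2.trans hb)
    have hlt := H (D.pts (i + 1)) ⟨ha.trans h2.1, h2.2.trans hb⟩ (D.pts i)
      ⟨ha.trans h1.1, h1.2.trans hb⟩ (by
        rw [Real.dist_eq, abs_of_nonneg (by linarith)]; exact hD i hi)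
    rw [Real.dist_eq, abs_of_nonneg h0] at hlt
    have hpow : (τ (D.pts (i + 1)) - τ (D.pts i)) ^ (θ - 1) ≤ ε / (2 * M) := by
      refine (Real.rpow_le_rpow h0 hlt.le (by linarith)).trans (le_of_eq ?_)
      rw [← Real.rpow_mul (by positivity), one_div_mul_cancel (by linarith), Real.rpow_one]
    calc (τ (D.pts (i + 1)) - τ (D.pts i)) ^ θ
        = (τ (D.pts (i + 1)) - τ (D.pts i)) ^ (θ - 1) * (τ (D.pts (i + 1)) - τ (D.pts i)) := by
          conv_lhs => rw [show θ = (θ - 1) + 1 by ring]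
          rw [Real.rpow_add_of_nonneg h0 (by linarith) zero_le_one, Real.rpow_one]
      _ ≤ _ := mul_le_mul_of_nonneg_right hpow h0
  refine (Finset.sum_le_sum hterm).trans_lt ?_
  rw [← Finset.mul_sum, Finset.sum_range_sub (fun i => τ (D.pts i)), D.left, D.right]
  have hle : τ b - τ a ≤ M := by
    linarith [hτ.sub_le ha D.le hb, le_abs_self (τ T - τ 0)]
  calc ε / (2 * M) * (τ b - τ a) ≤ ε / (2 * M) * M := by gcongr
    _ = ε / 2 := by field_simp
    _ < ε := by linarith

/-- The partition of `[a, b]` into `n + 1` intervals of equal length. -/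
noncomputable def Partition.uniform {a b : ℝ} (h : a ≤ b) (n : ℕ) : Partition a b where
  n := n + 1
  pts := fun i => a + min ((i : ℝ) / (n + 1)) 1 * (b - a)
  mono := by
    intro i j hij
    have : (i : ℝ) ≤ j := by exact_mod_cast hij
    have h' : 0 ≤ b - a := by linarith
    dsimp only
    gcongr
  left := by simp
  right := by
    have : ((n : ℝ) + 1) / (n + 1) = 1 := div_self (by positivity)
    simp [this]

lemma Partition.uniform_mesh {a b : ℝ} (h : a ≤ b) (n i : ℕ) :
    (Partition.uniform h n).pts (i + 1) - (Partition.uniform h n).pts i ≤ (b - a) / (n + 1) := by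
  have h' : 0 ≤ b - a := by linarith
  have hn : (0 : ℝ) < n + 1 := by positivity
  have key : min (((i : ℝ) + 1) / (n + 1)) 1 ≤ min ((i : ℝ) / (n + 1)) 1 + 1 / (n + 1) := by
    rw [← min_add_add_right, ← add_div]
    exact min_le_min le_rfl (by simp; positivity)
  have e : (b - a) / (n + 1) = 1 / (n + 1) * (b - a) := by ring
  simp only [Partition.uniform]
  push_cast
  rw [e]
  nlinarith [mul_le_mul_of_nonneg_right key h']

lemma eventually_uniform_mesh {a b : ℝ} (h : a ≤ b) {δ : ℝ} (hδ : 0 < δ) :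
    ∀ᶠ n : ℕ in atTop, ∀ i,
      (Partition.uniform h n).pts (i + 1) - (Partition.uniform h n).pts i < δ := by
  have : Tendsto (fun n : ℕ => (b - a) / ((n : ℝ) + 1)) atTop (𝓝 0) :=
    tendsto_const_nhds.div_atTop (tendsto_natCast_atTop_atTop.atTop_add tendsto_const_nhds)
  filter_upwards [this.eventually_lt_const hδ] with n hn i
  exact (Partition.uniform_mesh h n i).trans_lt hn

variable {H : Type*} [NormedAddCommGroup H]

/-- Two additive functions that differ by a term of order `> 1` coincide. -/
lemma eq_of_additive_of_le (hτ : IsClock T τ) (hθ : 1 < θ) {g : ℝ → ℝ → H} {C : ℝ}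
    (hadd : ∀ s u t, 0 ≤ s → s ≤ u → u ≤ t → t ≤ T → g s t = g s u + g u t)
    (hg : ∀ s t, 0 ≤ s → s ≤ t → t ≤ T → ‖g s t‖ ≤ C * (τ t - τ s) ^ θ)
    {s t : ℝ} (hs : 0 ≤ s) (hst : s ≤ t) (ht : t ≤ T) : g s t = 0 := by
  by_contra hne
  have hpos : 0 < ‖g s t‖ := norm_pos_iff.2 hne
  obtain ⟨δ, hδ, hmesh⟩ := hτ.exists_mesh hθ (ε := ‖g s t‖ / (|C| + 1)) (by positivity)
  obtain ⟨n, hn⟩ := (eventually_uniform_mesh hst hδ).exists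
  set D := Partition.uniform hst n
  have hsum := hmesh s t hs ht D fun i _ => hn i
  have hdiag : g s s = 0 := by
    have := hadd s s s hs le_rfl le_rfl (hst.trans ht)
    simpa using this
  have htel : ∀ k ≤ D.n, g s (D.pts k) = ∑ i ∈ Finset.range k, g (D.pts i) (D.pts (i + 1)) := by
    intro k
    induction k with
    | zero => intro _; simp [D.left, hdiag]
    | succ k ih =>
      intro hk
      rw [Finset.sum_range_succ, ← ih (Nat.le_of_succ_le hk)]
      exact hadd _ _ _ hs (D.mem_Icc (Nat.le_of_succ_le hk)).1 (D.mono (Nat.le_succ k))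
        ((D.mem_Icc hk).2.trans ht)
  have := htel D.n le_rfl
  rw [D.right] at this
  have hle : ‖g s t‖ ≤ |C| * ∑ i ∈ Finset.range D.n, (τ (D.pts (i + 1)) - τ (D.pts i)) ^ θ := by
    rw [this, Finset.mul_sum]
    refine norm_sum_le_of_le _ fun i hi => ?_
    have hi := Finset.mem_range.1 hi
    have h1 := hs.trans (D.mem_Icc hi.le).1
    have h2 := (D.mem_Icc (Nat.succ_le_of_lt hi)).2.trans ht
    refine (hg _ _ h1 (D.mono (Nat.le_succ i)) h2).trans ?_
    have := hτ.sub_nonneg h1 (D.mono (Nat.le_succ i)) h2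
    gcongr
    exact le_abs_self C
  rw [lt_div_iff₀ (by positivity)] at hsum
  nlinarith [abs_nonneg C, Finset.sum_nonneg fun i (hi : i ∈ Finset.range D.n) =>
    Real.rpow_nonneg (hτ.sub_nonneg (hs.trans (D.mem_Icc (Finset.mem_range.1 hi).le).1)
      (D.mono (Nat.le_succ i)) ((D.mem_Icc (Nat.succ_le_of_lt (Finset.mem_range.1 hi))).2.trans ht))
      θ]

lemma germ_diag (hθ : 1 < θ) {A : ℝ → ℝ → H} {C : ℝ}
    (hA : ∀ s u t, 0 ≤ s → s ≤ u → u ≤ t → t ≤ T →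
      ‖A s t - A s u - A u t‖ ≤ C * (τ t - τ s) ^ θ) {s : ℝ} (hs : 0 ≤ s) (hsT : s ≤ T) :
    A s s = 0 := by
  have := hA s s s hs le_rfl le_rfl hsT
  rw [sub_self, sub_self, Real.zero_rpow (by linarith), mul_zero, zero_sub, norm_neg] at this
  exact norm_le_zero_iff.1 this

/-- The sum of an almost additive germ over any partition of `[s, t]` differs from `A s t` by at
most a constant times `(τ t - τ s) ^ θ`. The partition is split at the interval that contains the
midpoint with respect to the clock; both parts carry at most half of `τ t - τ s`, and
`2 * (1 / 2) ^ θ < 1`. -/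
lemma norm_sum_sub_le (hτ : IsClock T τ) (hθ : 1 < θ) {A : ℝ → ℝ → H} {C : ℝ} (hC : 0 ≤ C)
    (hA : ∀ s u t, 0 ≤ s → s ≤ u → u ≤ t → t ≤ T →
      ‖A s t - A s u - A u t‖ ≤ C * (τ t - τ s) ^ θ) (n : ℕ) :
    ∀ x : ℕ → ℝ, Monotone x → 0 ≤ x 0 → x n ≤ T →
      ‖∑ i ∈ Finset.range n, A (x i) (x (i + 1)) - A (x 0) (x n)‖ ≤
        2 * C / (1 - 2 * (1 / 2) ^ θ) * (τ (x n) - τ (x 0)) ^ θ := by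
  have hhalf : 2 * (1 / 2 : ℝ) ^ θ < 1 := by
    have : (1 / 2 : ℝ) ^ θ < (1 / 2 : ℝ) ^ (1 : ℝ) :=
      Real.rpow_lt_rpow_of_exponent_gt (by norm_num) (by norm_num) hθ
    rw [Real.rpow_one] at this
    linarith
  set K := 2 * C / (1 - 2 * (1 / 2) ^ θ) with hK
  have hK0 : 0 ≤ K := div_nonneg (by linarith) (by linarith)
  have hKeq : 2 * (K * (1 / 2) ^ θ) + 2 * C = K := by
    have : K * (1 - 2 * (1 / 2) ^ θ) = 2 * C := div_mul_cancel₀ _ (by linarith)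
    linarith
  induction n using Nat.strong_induction_on with
  | _ n ih =>
  intro x hx h0 hn
  have hpos : ∀ i, 0 ≤ x i := fun i => h0.trans (hx (Nat.zero_le i))
  rcases Nat.eq_zero_or_pos n with rfl | hnpos
  · rw [Finset.sum_range_zero, germ_diag hθ hA h0 hn, sub_self, sub_self, norm_zero,
      Real.zero_rpow (by linarith), mul_zero]
  set Δ := τ (x n) - τ (x 0) with hΔ
  have hΔ0 : 0 ≤ Δ := hτ.sub_nonneg h0 (hx (Nat.zero_le n)) hn
  classical
  set i := Nat.findGreatest (fun j => τ (x j) - τ (x 0) ≤ Δ / 2) (n - 1) with hi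
  have hin : i < n := by
    have := Nat.findGreatest_le (P := fun j => τ (x j) - τ (x 0) ≤ Δ / 2) (n - 1)
    omega
  have hi1 : τ (x i) - τ (x 0) ≤ Δ / 2 :=
    Nat.findGreatest_spec (P := fun j => τ (x j) - τ (x 0) ≤ Δ / 2) (Nat.zero_le (n - 1))
      (by rw [sub_self]; linarith)
  have hi2 : τ (x n) - τ (x (i + 1)) ≤ Δ / 2 := by
    rcases Nat.lt_or_ge (i + 1) n with h | h
    · have := Nat.findGreatest_is_greatest (P := fun j => τ (x j) - τ (x 0) ≤ Δ / 2)
        (n := n - 1) (k := i + 1) (by omega) (by omega)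
      rw [not_le] at this
      linarith
    · rw [show i + 1 = n by omega, sub_self]
      linarith
  obtain ⟨m, hm⟩ : ∃ m, n = i + 1 + m := ⟨n - (i + 1), by omega⟩
  have hxi : x i ≤ T := (hx hin.le).trans hn
  have hxi1 : x (i + 1) ≤ x n := hx (by omega)
  have b1 := ih i hin x hx h0 hxi
  have b2 := ih m (by omega) (fun j => x (i + 1 + j)) (fun j k hjk => hx (by omega))
    (hpos _) (by rw [← hm]; exact hn)
  simp only [Nat.add_zero, ← hm] at b2
  have b3 := hA (x 0) (x i) (x n) h0 (hx (Nat.zero_le i)) (hx hin.le) hn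
  have b4 := hA (x i) (x (i + 1)) (x n) (hpos i) (hx (Nat.le_succ i)) hxi1 hn
  have hsplit : ∑ j ∈ Finset.range n, A (x j) (x (j + 1)) =
      ∑ j ∈ Finset.range i, A (x j) (x (j + 1)) + A (x i) (x (i + 1)) +
        ∑ j ∈ Finset.range m, A (x (i + 1 + j)) (x (i + 1 + (j + 1))) := by
    conv_lhs => rw [hm]
    rw [Finset.sum_range_add, Finset.sum_range_succ]
    rfl
  have g1 := hτ.sub_nonneg h0 (hx (Nat.zero_le i)) hxi
  have g2 := hτ.sub_nonneg (hpos (i + 1)) hxi1 hn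
  have g3 := hτ.sub_nonneg (hpos i) (hx hin.le) hn
  have e : ∀ y, 0 ≤ y → y ≤ Δ / 2 → K * y ^ θ ≤ K * (1 / 2) ^ θ * Δ ^ θ := by
    intro y hy hyΔ
    rw [mul_assoc, ← Real.mul_rpow (by norm_num) hΔ0]
    gcongr
    linarith
  have c1 := b1.trans (e _ g1 hi1)
  have c2 := b2.trans (e _ g2 hi2)
  have c4 : ‖A (x i) (x n) - A (x i) (x (i + 1)) - A (x (i + 1)) (x n)‖ ≤ C * Δ ^ θ := by
    refine b4.trans ?_
    gcongr
    linarith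
  have hid : ∑ j ∈ Finset.range n, A (x j) (x (j + 1)) - A (x 0) (x n) =
      (∑ j ∈ Finset.range i, A (x j) (x (j + 1)) - A (x 0) (x i)) +
      (∑ j ∈ Finset.range m, A (x (i + 1 + j)) (x (i + 1 + (j + 1))) - A (x (i + 1)) (x n)) -
      (A (x 0) (x n) - A (x 0) (x i) - A (x i) (x n)) -
      (A (x i) (x n) - A (x i) (x (i + 1)) - A (x (i + 1)) (x n)) := by
    rw [hsplit]; abel
  rw [hid]
  refine (norm_sub_le _ _).trans ((add_le_add_left (norm_sub_le _ _) _).trans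
    ((add_le_add_left (add_le_add_left (norm_add_le _ _) _) _).trans ?_))
  calc _ ≤ K * (1 / 2) ^ θ * Δ ^ θ + K * (1 / 2) ^ θ * Δ ^ θ + C * Δ ^ θ + C * Δ ^ θ :=
        add_le_add (add_le_add (add_le_add c1 c2) b3) c4
    _ = (2 * (K * (1 / 2) ^ θ) + 2 * C) * Δ ^ θ := by ring
    _ = K * Δ ^ θ := by rw [hKeq]

variable [NormedSpace ℝ H] [FiniteDimensional ℝ H]

/-- The sewing lemma: an almost additive germ `A` is, up to a term of order `θ > 1`, the increment
of a path. The path is a limit, along an ultrafilter, of the sums of `A` over uniform partitions of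
`[0, T]` stopped at `t`. -/
theorem exists_sewing (hT : 0 ≤ T) (hτ : IsClock T τ) (hθ : 1 < θ) {A : ℝ → ℝ → H}
    (hA : OfOrder (triples T) (gap₃ τ) θ
      fun z => A z.1 z.2.2 - A z.1 z.2.1 - A z.2.1 z.2.2) :
    ∃ I : ℝ → H, OfOrder (simplex T) (gap τ) θ fun z => I z.2 - I z.1 - A z.1 z.2 := by
  obtain ⟨C, hC, hA⟩ := hA
  replace hA : ∀ s u t, 0 ≤ s → s ≤ u → u ≤ t → t ≤ T →
      ‖A s t - A s u - A u t‖ ≤ C * (τ t - τ s) ^ θ :=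
    fun s u t h1 h2 h3 h4 => hA (s, u, t) ⟨h1, h2, h3, h4⟩
  have hdiag : ∀ s, 0 ≤ s → s ≤ T → A s s = 0 := fun s h1 h2 => germ_diag hθ hA h1 h2
  set K := 2 * C / (1 - 2 * (1 / 2) ^ θ) with hK
  have hfin := fun n => norm_sum_sub_le hτ hθ hC hA n
  rw [← hK] at hfin
  set d : ℕ → ℕ → ℝ := fun n => (Partition.uniform hT n).pts with hd
  have hdm : ∀ n, Monotone (d n) := fun n => (Partition.uniform hT n).mono
  have hd0 : ∀ n, d n 0 = 0 := fun n => (Partition.uniform hT n).left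
  have hdT : ∀ n, d n (n + 1) = T := fun n => (Partition.uniform hT n).right
  have hdpos : ∀ n i, 0 ≤ d n i := fun n i => hd0 n ▸ hdm n (Nat.zero_le i)
  set S : ℕ → ℝ → H := fun n t =>
    ∑ i ∈ Finset.range (n + 1), A (min t (d n i)) (min t (d n (i + 1))) with hS
  have hlim : ∀ t ∈ Icc 0 T, ∃ y, Tendsto (fun n => S n t) (hyperfilter ℕ : Filter ℕ) (𝓝 y) := by
    intro t ht
    have hb : ∀ n, S n t ∈ Metric.closedBall (A 0 t) (K * (τ t - τ 0) ^ θ) := by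
      intro n
      have := hfin (n + 1) (fun i => min t (d n i)) (fun i j hij => min_le_min le_rfl (hdm n hij))
        (by rw [hd0, min_eq_right ht.1]) ((min_le_left _ _).trans ht.2)
      simp only [hd0, hdT, min_eq_right ht.1, min_eq_left ht.2] at this
      rwa [Metric.mem_closedBall, dist_eq_norm]
    have hc : IsCompact (Metric.closedBall (A 0 t) (K * (τ t - τ 0) ^ θ)) :=
      isCompact_closedBall _ _
    obtain ⟨y, -, hy⟩ := hc.ultrafilter_le_nhds ((hyperfilter ℕ).map fun n => S n t)
      (by
        rw [le_principal_iff]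
        exact Eventually.of_forall (f := (hyperfilter ℕ : Filter ℕ)) hb)
    exact ⟨y, hy⟩
  choose! I hI using hlim
  refine ⟨I, |K|, abs_nonneg K, fun z hz => ?_⟩
  obtain ⟨s, t⟩ := z
  obtain ⟨hs, hst, ht⟩ := hz
  dsimp only at hs hst ht ⊢
  set E : ℕ → ℝ := fun n =>
    C * ∑ i ∈ Finset.range (n + 1), (τ (d n (i + 1)) - τ (d n i)) ^ θ with hE
  have hE0 : Tendsto E (hyperfilter ℕ : Filter ℕ) (𝓝 0) := by
    refine Tendsto.mono_left ?_ Nat.hyperfilter_le_atTop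
    rw [show (0 : ℝ) = C * 0 by simp]
    refine Tendsto.const_mul C ?_
    rw [Metric.tendsto_nhds]
    intro ε hε
    obtain ⟨δ, hδ, hmesh⟩ := hτ.exists_mesh hθ hε
    filter_upwards [eventually_uniform_mesh hT hδ] with n hn
    have := hmesh 0 T le_rfl le_rfl (Partition.uniform hT n) fun i _ => hn i
    rw [Real.dist_eq, sub_zero, abs_of_nonneg]
    · exact this
    · refine Finset.sum_nonneg fun i hi => Real.rpow_nonneg (hτ.sub_nonneg (hdpos n i)
        (hdm n (Nat.le_succ i)) ?_) _
      exact hdT n ▸ hdm n (Finset.mem_range.1 hi)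
  -- The sums over `[0, t]` and `[0, s]` differ by a sum over `[s, t]`, except for the germ's
  -- lack of additivity on the interval that contains `s`.
  have hbound : ∀ n, ‖S n t - S n s - A s t‖ ≤ |K| * (τ t - τ s) ^ θ + E n := by
    intro n
    set c : ℕ → ℝ := fun i => max s (min t (d n i)) with hc
    have hcell : ∀ i ∈ Finset.range (n + 1),
        ‖A (min t (d n i)) (min t (d n (i + 1))) - A (min s (d n i)) (min s (d n (i + 1))) -
          A (c i) (c (i + 1))‖ ≤ C * (τ (d n (i + 1)) - τ (d n i)) ^ θ := by
      intro i hi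
      have hle := hdm n (Nat.le_succ i)
      have hiT : d n (i + 1) ≤ T := hdT n ▸ hdm n (Finset.mem_range.1 hi)
      have hnn := hτ.sub_nonneg (hdpos n i) hle hiT
      have hR : 0 ≤ C * (τ (d n (i + 1)) - τ (d n i)) ^ θ := by positivity
      rcases le_total s (d n i) with h1 | h1
      · have e1 : min s (d n i) = s := min_eq_left h1
        have e2 : min s (d n (i + 1)) = s := min_eq_left (h1.trans hle)
        have e3 : c i = min t (d n i) := max_eq_right (le_min hst h1)
        have e4 : c (i + 1) = min t (d n (i + 1)) := max_eq_right (le_min hst (h1.trans hle))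
        rw [e1, e2, e3, e4, hdiag s hs (hst.trans ht), sub_zero, sub_self, norm_zero]
        exact hR
      · have e1 : min s (d n i) = d n i := min_eq_right h1
        have e2 : min t (d n i) = d n i := min_eq_right (h1.trans hst)
        have e3 : c i = s := by simp only [hc, e2]; exact max_eq_left h1
        rcases le_total s (d n (i + 1)) with h2 | h2
        · have e4 : min s (d n (i + 1)) = s := min_eq_left h2
          have e5 : c (i + 1) = min t (d n (i + 1)) := max_eq_right (le_min hst h2)
          rw [e1, e2, e3, e4, e5]
          refine (hA _ _ _ (hdpos n i) h1 (le_min hst h2) ((min_le_left _ _).trans ht)).trans ?_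
          have m1 : d n i ≤ min t (d n (i + 1)) := le_min (h1.trans hst) hle
          have := hτ.sub_nonneg (hdpos n i) m1 ((min_le_left _ _).trans ht)
          have := hτ.sub_nonneg ((hdpos n i).trans m1) (min_le_right t (d n (i + 1))) hiT
          gcongr
          linarith
        · have e4 : min s (d n (i + 1)) = d n (i + 1) := min_eq_right h2
          have e5 : min t (d n (i + 1)) = d n (i + 1) := min_eq_right (h2.trans hst)
          have e6 : c (i + 1) = s := by simp only [hc, e5]; exact max_eq_left h2
          rw [e1, e2, e3, e4, e5, e6, hdiag s hs (hst.trans ht), sub_self, sub_self, norm_zero]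
          exact hR
    have h2 := hfin (n + 1) c (fun i j hij => max_le_max le_rfl (min_le_min le_rfl (hdm n hij)))
      (hs.trans (le_max_left _ _)) (max_le (hst.trans ht) ((min_le_left _ _).trans ht))
    have ec0 : c 0 = s := by simp only [hc, hd0]; rw [min_eq_right (hs.trans hst), max_eq_left hs]
    have ecn : c (n + 1) = t := by
      simp only [hc, hdT]; rw [min_eq_left ht, max_eq_right hst]
    rw [ec0, ecn] at h2
    have h3 : ‖∑ i ∈ Finset.range (n + 1), (A (min t (d n i)) (min t (d n (i + 1))) -
        A (min s (d n i)) (min s (d n (i + 1))) - A (c i) (c (i + 1)))‖ ≤ E n := by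
      rw [hE]
      dsimp only
      rw [Finset.mul_sum]
      exact norm_sum_le_of_le _ hcell
    rw [Finset.sum_sub_distrib, Finset.sum_sub_distrib] at h3
    have hnn := hτ.sub_nonneg hs hst ht
    have h4 : K * (τ t - τ s) ^ θ ≤ |K| * (τ t - τ s) ^ θ := by
      gcongr
      exact le_abs_self K
    calc ‖S n t - S n s - A s t‖ = ‖(∑ i ∈ Finset.range (n + 1), A (c i) (c (i + 1)) - A s t) +
          (S n t - S n s - ∑ i ∈ Finset.range (n + 1), A (c i) (c (i + 1)))‖ := by
          congr 1; abel
      _ ≤ |K| * (τ t - τ s) ^ θ + E n := (norm_add_le _ _).trans (add_le_add (h2.trans h4) h3)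
  have hl1 : Tendsto (fun n => ‖S n t - S n s - A s t‖) (hyperfilter ℕ : Filter ℕ)
      (𝓝 ‖I t - I s - A s t‖) :=
    (((hI t ⟨hs.trans hst, ht⟩).sub (hI s ⟨hs, hst.trans ht⟩)).sub_const _).norm
  have hl2 : Tendsto (fun n => |K| * (τ t - τ s) ^ θ + E n) (hyperfilter ℕ : Filter ℕ)
      (𝓝 (|K| * (τ t - τ s) ^ θ + 0)) := hE0.const_add _
  rw [add_zero] at hl2
  exact le_of_tendsto_of_tendsto' hl1 hl2 hbound

end Sewing

/-! ### Stieltjes and Young integrals -/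

section Young

variable {G H K : Type*} [NormedAddCommGroup G] [NormedSpace ℝ G]
  [NormedAddCommGroup H] [NormedSpace ℝ H] [NormedAddCommGroup K] [NormedSpace ℝ K]
  {Y Y' : ℝ → G →L[ℝ] H} {Z : ℝ → G} {a b : ℝ} {I I' : H}

lemma HasStieltjesIntegral.sub (h : HasStieltjesIntegral Y Z a b I)
    (h' : HasStieltjesIntegral Y' Z a b I') :
    HasStieltjesIntegral (fun u => Y u - Y' u) Z a b (I - I') := by
  intro ε hε
  obtain ⟨δ, hδ, H⟩ := h (ε / 2) (half_pos hε)
  obtain ⟨δ', hδ', H'⟩ := h' (ε / 2) (half_pos hε)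
  refine ⟨min δ δ', lt_min hδ hδ', fun D ξ hD hξ => ?_⟩
  have h1 := H D ξ (fun i hi => (hD i hi).trans_le (min_le_left _ _)) hξ
  have h2 := H' D ξ (fun i hi => (hD i hi).trans_le (min_le_right _ _)) hξ
  simp only [sub_apply, Finset.sum_sub_distrib]
  rw [sub_sub_sub_comm]
  exact (norm_sub_le _ _).trans_lt (by linarith)

lemma HasStieltjesIntegral.const (L : G →L[ℝ] H) :
    HasStieltjesIntegral (fun _ => L) Z a b (L (Z b - Z a)) := by
  intro ε hε
  refine ⟨1, one_pos, fun D ξ _ _ => ?_⟩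
  rw [← map_sum]
  simp only [increment]
  rw [Finset.sum_range_sub (fun i => Z (D.pts i)), D.left, D.right, sub_self, norm_zero]
  exact hε

lemma HasStieltjesIntegral.clm_comp (L : H →L[ℝ] K) (h : HasStieltjesIntegral Y Z a b I) :
    HasStieltjesIntegral (fun u => L.comp (Y u)) Z a b (L I) := by
  intro ε hε
  obtain ⟨δ, hδ, H⟩ := h (ε / (‖L‖ + 1)) (by positivity)
  refine ⟨δ, hδ, fun D ξ hD hξ => ?_⟩
  have h1 := H D ξ hD hξ
  rw [lt_div_iff₀ (by positivity)] at h1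
  simp only [ContinuousLinearMap.comp_apply, ← map_sum, ← map_sub]
  refine (L.le_opNorm _).trans_lt (lt_of_le_of_lt ?_ h1)
  nlinarith [norm_nonneg (∑ i ∈ Finset.range D.n,
    Y (ξ i) (increment Z (D.pts i) (D.pts (i + 1))) - I)]

lemma HasStieltjesIntegral.congr (h : HasStieltjesIntegral Y Z a b I)
    (hY : ∀ u ∈ Icc a b, Y' u = Y u) : HasStieltjesIntegral Y' Z a b I := by
  intro ε hε
  obtain ⟨δ, hδ, H⟩ := h ε hε
  refine ⟨δ, hδ, fun D ξ hD hξ => ?_⟩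
  rw [Finset.sum_congr rfl fun i hi => by
    have hi := Finset.mem_range.1 hi
    rw [hY (ξ i) ⟨(D.mem_Icc hi.le).1.trans (hξ i hi).1,
      (hξ i hi).2.trans (D.mem_Icc (Nat.succ_le_of_lt hi)).2⟩]]
  exact H D ξ hD hξ

lemma HasStieltjesIntegral.unique (hab : a ≤ b) (h : HasStieltjesIntegral Y Z a b I)
    (h' : HasStieltjesIntegral Y Z a b I') : I = I' := by
  by_contra hne
  have hpos : 0 < ‖I' - I‖ := norm_pos_iff.2 (sub_ne_zero.2 (Ne.symm hne))
  obtain ⟨δ, hδ, H⟩ := h (‖I' - I‖ / 2) (half_pos hpos)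
  obtain ⟨δ', hδ', H'⟩ := h' (‖I' - I‖ / 2) (half_pos hpos)
  obtain ⟨n, hn⟩ := (eventually_uniform_mesh hab (lt_min hδ hδ')).exists
  set D := Partition.uniform hab n
  have hξ : ∀ i < D.n, D.pts i ∈ Icc (D.pts i) (D.pts (i + 1)) := fun i _ =>
    left_mem_Icc.2 (D.mono (Nat.le_succ i))
  have h1 := H D D.pts (fun i _ => (hn i).trans_le (min_le_left _ _)) hξ
  have h2 := H' D D.pts (fun i _ => (hn i).trans_le (min_le_right _ _)) hξ
  have h3 := norm_sub_le (∑ i ∈ Finset.range D.n,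
      Y (D.pts i) (increment Z (D.pts i) (D.pts (i + 1))) - I) (∑ i ∈ Finset.range D.n,
      Y (D.pts i) (increment Z (D.pts i) (D.pts (i + 1))) - I')
  rw [sub_sub_sub_cancel_left] at h3
  linarith

lemma HasStieltjesIntegral.youngIntegral_eq (hab : a ≤ b) (h : HasStieltjesIntegral Y Z a b I) :
    youngIntegral Y Z a b = I := by
  have hex : ∃ I : H, HasStieltjesIntegral Y Z a b I := ⟨I, h⟩
  rw [youngIntegral, dif_pos hex]
  exact hex.choose_spec.unique hab h

variable {T : ℝ} {τ : ℝ → ℝ} {α β : ℝ}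

/-- An integrand and an integrator of complementary orders have complementary finite variations. -/
lemma HasStieltjesIntegral.youngIntegrable (hτ : IsClock T τ) (hα : 0 < α) (hα1 : α ≤ 1)
    (hβ : 0 < β) (hβ1 : β ≤ 1) (hαβ : 1 < α + β)
    (hY : OfOrder (simplex T) (gap τ) α fun z => Y z.2 - Y z.1)
    (hZ : OfOrder (simplex T) (gap τ) β fun z => Z z.2 - Z z.1)
    (ha : 0 ≤ a) (hb : b ≤ T) (h : HasStieltjesIntegral Y Z a b I) : YoungIntegrable Y Z a b := by
  refine ⟨⟨1 / α, 1 / β, ?_, ?_, ?_, ?_, ?_⟩, I, h⟩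
  · rwa [le_div_iff₀ hα, one_mul]
  · rwa [le_div_iff₀ hβ, one_mul]
  · rwa [one_div_one_div, one_div_one_div]
  · refine OfOrder.variation_ne_top hτ (by positivity) (g := increment Y) ?_ ha hb
    rw [one_div_one_div]
    exact hY
  · refine OfOrder.variation_ne_top hτ (by positivity) (g := increment Z) ?_ ha hb
    rw [one_div_one_div]
    exact hZ

lemma YoungIntegrable.congr (h : YoungIntegrable Y Z a b) (hY : ∀ u ∈ Icc a b, Y' u = Y u) :
    YoungIntegrable Y' Z a b := by
  obtain ⟨⟨α, β, hα, hβ, hαβ, h1, h2⟩, I, hI⟩ := h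
  refine ⟨⟨α, β, hα, hβ, hαβ, ?_, h2⟩, I, hI.congr hY⟩
  rwa [variation_congr (g' := increment Y) fun u v hu huv hv => by
    rw [increment, increment, hY u ⟨hu, huv.trans hv⟩, hY v ⟨hu.trans huv, hv⟩]]

/-- Young's theorem: for an integrand and an integrator of complementary orders the Stieltjes
integral exists, as the increment of a path that differs from `Y s (Z t - Z s)` by a term of the
sum of the orders. -/
theorem exists_young [FiniteDimensional ℝ H] (hT : 0 ≤ T) (hτ : IsClock T τ) (hα : 0 ≤ α)
    (hβ : 0 ≤ β) (hαβ : 1 < α + β)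
    (hY : OfOrder (simplex T) (gap τ) α fun z => Y z.2 - Y z.1)
    (hZ : OfOrder (simplex T) (gap τ) β fun z => Z z.2 - Z z.1) :
    ∃ J : ℝ → H,
      OfOrder (simplex T) (gap τ) (α + β) (fun z => J z.2 - J z.1 - Y z.1 (Z z.2 - Z z.1)) ∧
      ∀ s t, 0 ≤ s → s ≤ t → t ≤ T → HasStieltjesIntegral Y Z s t (J t - J s) := by
  obtain ⟨J, hJ⟩ := exists_sewing hT hτ hαβ (A := fun s t => Y s (Z t - Z s)) (by
    refine ((hY.restrict_left hτ hα).clm_apply hτ.isGauge₃ hα hβ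
      (hZ.restrict_right hτ hβ)).neg.congr fun z _ => ?_
    rw [← sub_add_sub_cancel (Z z.2.2) (Z z.2.1) (Z z.1), map_add]
    simp only [sub_apply]
    abel)
  refine ⟨J, hJ, fun s t hs hst ht ε hε => ?_⟩
  obtain ⟨C, hC, hJ⟩ := hJ
  obtain ⟨C₁, hC₁, hY⟩ := hY
  obtain ⟨C₂, hC₂, hZ⟩ := hZ
  obtain ⟨δ, hδ, hmesh⟩ := hτ.exists_mesh hαβ (ε := ε / (C + C₁ * C₂ + 1)) (by positivity)
  refine ⟨δ, hδ, fun D ξ hD hξ => ?_⟩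
  have hsum := hmesh s t hs ht D hD
  have hterm : ∀ i ∈ Finset.range D.n,
      ‖Y (ξ i) (increment Z (D.pts i) (D.pts (i + 1))) - (J (D.pts (i + 1)) - J (D.pts i))‖ ≤
        (C + C₁ * C₂) * (τ (D.pts (i + 1)) - τ (D.pts i)) ^ (α + β) := by
    intro i hi
    have hi := Finset.mem_range.1 hi
    have h1 := hs.trans (D.mem_Icc hi.le).1
    have h2 := (D.mem_Icc (Nat.succ_le_of_lt hi)).2.trans ht
    obtain ⟨h3, h4⟩ := hξ i hi
    have hm := D.mono (Nat.le_succ i)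
    have g0 := hτ.sub_nonneg h1 hm h2
    have g1 := hτ.sub_nonneg h1 h3 (h4.trans h2)
    have g2 := hτ.sub_nonneg (h1.trans h3) h4 h2
    have b1 := hJ (D.pts i, D.pts (i + 1)) ⟨h1, hm, h2⟩
    have b2 := hY (D.pts i, ξ i) ⟨h1, h3, h4.trans h2⟩
    have b3 := hZ (D.pts i, D.pts (i + 1)) ⟨h1, hm, h2⟩
    simp only [gap] at b1 b2 b3
    have b4 : ‖(Y (ξ i) - Y (D.pts i)) (Z (D.pts (i + 1)) - Z (D.pts i))‖ ≤
        C₁ * C₂ * (τ (D.pts (i + 1)) - τ (D.pts i)) ^ (α + β) := by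
      rw [Real.rpow_add_of_nonneg g0 hα hβ]
      calc _ ≤ ‖Y (ξ i) - Y (D.pts i)‖ * ‖Z (D.pts (i + 1)) - Z (D.pts i)‖ :=
            ContinuousLinearMap.le_opNorm _ _
        _ ≤ (C₁ * (τ (D.pts (i + 1)) - τ (D.pts i)) ^ α) *
            (C₂ * (τ (D.pts (i + 1)) - τ (D.pts i)) ^ β) := by
            refine mul_le_mul (b2.trans ?_) b3 (norm_nonneg _) (by positivity)
            gcongr
            linarith
        _ = _ := by ring
    calc _ = ‖(Y (ξ i) - Y (D.pts i)) (Z (D.pts (i + 1)) - Z (D.pts i)) -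
          (J (D.pts (i + 1)) - J (D.pts i) - Y (D.pts i) (Z (D.pts (i + 1)) - Z (D.pts i)))‖ := by
          congr 1
          simp only [increment, sub_apply]
          abel
      _ ≤ _ := (norm_sub_le _ _).trans (by rw [add_mul]; linarith)
  have htel : J t - J s = ∑ i ∈ Finset.range D.n, (J (D.pts (i + 1)) - J (D.pts i)) := by
    rw [Finset.sum_range_sub (fun i => J (D.pts i)), D.left, D.right]
  rw [htel, ← Finset.sum_sub_distrib]
  refine (norm_sum_le_of_le _ hterm).trans_lt ?_
  rw [← Finset.mul_sum]
  rw [lt_div_iff₀ (by positivity)] at hsum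
  have hnn : 0 ≤ ∑ i ∈ Finset.range D.n, (τ (D.pts (i + 1)) - τ (D.pts i)) ^ (α + β) :=
    Finset.sum_nonneg fun i hi => by
      have hi := Finset.mem_range.1 hi
      exact Real.rpow_nonneg (hτ.sub_nonneg (hs.trans (D.mem_Icc hi.le).1) (D.mono (Nat.le_succ i))
        ((D.mem_Icc (Nat.succ_le_of_lt hi)).2.trans ht)) _
  nlinarith

/-- If the increments of two bounded paths are of order `α`, so are those of their product. -/
lemma OfOrder.bilin_increment (hτ : IsClock T τ) (hα : 0 ≤ α) (L : G →L[ℝ] H →L[ℝ] K)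
    {y : ℝ → G} {k : ℝ → H}
    (hy0 : OfOrder (simplex T) (gap τ) 0 fun z => y z.2)
    (hk0 : OfOrder (simplex T) (gap τ) 0 fun z => k z.1)
    (hy : OfOrder (simplex T) (gap τ) α fun z => y z.2 - y z.1)
    (hk : OfOrder (simplex T) (gap τ) α fun z => k z.2 - k z.1) :
    OfOrder (simplex T) (gap τ) α fun z => L (y z.2) (k z.2) - L (y z.1) (k z.1) := by
  have h1 := hy.bilin hτ.isGauge hα le_rfl L hk0
  have h2 := hy0.bilin hτ.isGauge le_rfl hα L hk
  rw [add_zero] at h1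
  rw [zero_add] at h2
  refine (h1.add h2).congr fun z _ => ?_
  simp only [map_sub, sub_apply]
  abel

end Young

/-! ### Lipschitz functions in the sense of Stein -/

section Lip

variable {V W : Type*} [NormedAddCommGroup V] [InnerProductSpace ℝ V]
  [NormedAddCommGroup W] [InnerProductSpace ℝ W]

/-- A `Lip(γ)` function, `γ > 2`, has bounded derivatives up to the second order, and its second
derivative is Hölder continuous of exponent `min γ 3 - 2`. -/
lemma IsLip.exists_bound {γ : ℝ} (hγ : 2 < γ) {F : V → W} (hF : IsLip γ F) :
    ContDiff ℝ 2 F ∧ ∃ M, 0 ≤ M ∧ (∀ x, ‖fderiv ℝ F x‖ ≤ M) ∧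
      (∀ x, ‖fderiv ℝ (fderiv ℝ F) x‖ ≤ M) ∧
      ∀ x y, ‖fderiv ℝ (fderiv ℝ F) y - fderiv ℝ (fderiv ℝ F) x‖ ≤
        M * ‖y - x‖ ^ (min γ 3 - 2) := by
  obtain ⟨k, M, hk1, hk2, hc, hb, hH⟩ := hF
  have hk : 2 ≤ k := by
    by_contra! h
    have : (k : ℝ) ≤ 1 := by exact_mod_cast Nat.lt_succ_iff.1 h
    linarith
  have hM : 0 ≤ M := (norm_nonneg _).trans (hb 0 (Nat.zero_le k) 0)
  refine ⟨hc.of_le (by exact_mod_cast hk), M, hM, fun x => ?_, fun x => ?_, ?_⟩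
  · rw [← norm_iteratedFDeriv_one]
    exact hb 1 (by omega) x
  · rw [← norm_iteratedFDeriv_one, norm_iteratedFDeriv_fderiv]
    exact hb 2 (by omega) x
  · intro x y
    rcases hk.eq_or_lt with rfl | hk3
    · push_cast at hk1 hk2 hH
      rw [min_eq_left (by linarith)]
      refine le_trans ?_ (hH y x)
      refine ContinuousLinearMap.opNorm_le_bound₂ _ (norm_nonneg _) fun v w => ?_
      have := (iteratedFDeriv ℝ 2 F y - iteratedFDeriv ℝ 2 F x).le_opNorm ![v, w]
      simpa [iteratedFDeriv_two_apply, Fin.prod_univ_two, mul_assoc] using this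
    · have hγ3 : 3 ≤ γ := by
        have : (3 : ℝ) ≤ k := by exact_mod_cast hk3
        linarith
      rw [min_eq_right hγ3, show (3 : ℝ) - 2 = 1 by norm_num, Real.rpow_one]
      have h3 : ContDiff ℝ 3 F := hc.of_le (by exact_mod_cast hk3)
      have h1 : ContDiff ℝ 1 (fderiv ℝ (fderiv ℝ F)) :=
        (h3.fderiv_right (m := 2) (by norm_num)).fderiv_right (by norm_num)
      have hd : Differentiable ℝ (fderiv ℝ (fderiv ℝ F)) := h1.differentiable (by norm_num)
      refine convex_univ.norm_image_sub_le_of_norm_fderiv_le (𝕜 := ℝ)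
        (f := fderiv ℝ (fderiv ℝ F)) (fun z _ => hd z)
        (fun z _ => ?_) (mem_univ x) (mem_univ y)
      rw [← norm_iteratedFDeriv_one, norm_iteratedFDeriv_fderiv, norm_iteratedFDeriv_fderiv]
      exact hb 3 hk3 z

/-- The first-order Taylor remainder of a function with Hölder continuous derivative. -/
lemma norm_taylor_one_le {E : Type*} [NormedAddCommGroup E] [NormedSpace ℝ E] {f : V → E}
    (hf : Differentiable ℝ f) {M κ : ℝ} (hM : 0 ≤ M) (hκ : 0 ≤ κ)
    (hH : ∀ x y, ‖fderiv ℝ f y - fderiv ℝ f x‖ ≤ M * ‖y - x‖ ^ κ) (x y : V) :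
    ‖f y - f x - fderiv ℝ f x (y - x)‖ ≤ M * ‖y - x‖ ^ (1 + κ) := by
  have key := (convex_closedBall x ‖y - x‖).norm_image_sub_le_of_norm_hasFDerivWithin_le
    (f := fun z => f z - fderiv ℝ f x z) (f' := fun z => fderiv ℝ f z - fderiv ℝ f x)
    (C := M * ‖y - x‖ ^ κ) (x := x) (y := y)
    (fun z _ => ((hf z).hasFDerivAt.sub (fderiv ℝ f x).hasFDerivAt).hasFDerivWithinAt)
    (fun z hz => (hH x z).trans (by
      rw [Metric.mem_closedBall, dist_eq_norm] at hz
      gcongr)) (by simp) (by simp [dist_eq_norm])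
  rw [add_comm 1 κ, Real.rpow_add_of_nonneg (norm_nonneg _) hκ zero_le_one, Real.rpow_one,
    ← mul_assoc, map_sub]
  rwa [show f y - fderiv ℝ f x y - (f x - fderiv ℝ f x x) =
    f y - f x - (fderiv ℝ f x y - fderiv ℝ f x x) by abel] at key

/-- The second-order Taylor remainder of a function with Hölder continuous second derivative. -/
lemma norm_taylor_two_le {F : V → W} (hF : ContDiff ℝ 2 F) {M κ : ℝ} (hM : 0 ≤ M) (hκ : 0 ≤ κ)
    (hH : ∀ x y, ‖fderiv ℝ (fderiv ℝ F) y - fderiv ℝ (fderiv ℝ F) x‖ ≤ M * ‖y - x‖ ^ κ) (x y : V) :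
    ‖F y - F x - fderiv ℝ F x (y - x) -
      (1 / 2 : ℝ) • fderiv ℝ (fderiv ℝ F) x (y - x) (y - x)‖ ≤ M * ‖y - x‖ ^ (2 + κ) := by
  have hdF : Differentiable ℝ F := hF.differentiable (by norm_num)
  have hd1 : Differentiable ℝ (fderiv ℝ F) :=
    (hF.fderiv_right (m := 1) (by norm_num)).differentiable (by norm_num)
  have hsymm : ∀ v w, fderiv ℝ (fderiv ℝ F) x v w = fderiv ℝ (fderiv ℝ F) x w v :=
    fun v w => second_derivative_symmetric (fun z => (hdF z).hasFDerivAt) (hd1 x).hasFDerivAt v w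
  set B := fderiv ℝ (fderiv ℝ F) x with hB
  have hquad : ∀ z, HasFDerivAt (fun z => (1 / 2 : ℝ) • B (z - x) (z - x)) (B (z - x)) z := by
    intro z
    have h1 : HasFDerivAt (fun z => z - x) (ContinuousLinearMap.id ℝ V) z :=
      (hasFDerivAt_id z).sub_const x
    have h2 := ((B.hasFDerivAt.comp z h1).clm_apply h1).const_smul (1 / 2 : ℝ)
    refine h2.congr_fderiv ?_
    ext v
    simp [hsymm v z, hsymm v x, ← add_smul]
    norm_num
  have key := (convex_closedBall x ‖y - x‖).norm_image_sub_le_of_norm_hasFDerivWithin_le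
    (f := fun z => F z - fderiv ℝ F x z - (1 / 2 : ℝ) • B (z - x) (z - x))
    (f' := fun z => fderiv ℝ F z - fderiv ℝ F x - B (z - x))
    (C := M * ‖y - x‖ ^ (1 + κ)) (x := x) (y := y)
    (fun z _ => (((hdF z).hasFDerivAt.sub (fderiv ℝ F x).hasFDerivAt).sub
      (hquad z)).hasFDerivWithinAt)
    (fun z hz => (norm_taylor_one_le hd1 hM hκ hH x z).trans (by
      rw [Metric.mem_closedBall, dist_eq_norm] at hz
      gcongr)) (by simp) (by simp [dist_eq_norm])
  rw [show (2 : ℝ) + κ = (1 + κ) + 1 by ring, Real.rpow_add_of_nonneg (norm_nonneg _)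
    (by linarith) zero_le_one, Real.rpow_one, ← mul_assoc]
  refine le_trans (le_of_eq ?_) key
  congr 1
  simp only [sub_self, map_zero, smul_zero, sub_zero, map_sub]
  abel

end Lip

/-! ### Linear maps on tensor products -/

section Tensor

variable {V W : Type*} [NormedAddCommGroup V] [InnerProductSpace ℝ V]
  [NormedAddCommGroup W] [InnerProductSpace ℝ W] [FiniteDimensional ℝ V]

lemma tensorLift_tmul (B : V →L[ℝ] V →L[ℝ] W) (v w : V) : tensorLift B (v ⊗ₜ w) = B v w := by
  simp [tensorLift]

lemma tensorSq_tmul (A : V →L[ℝ] W) (v w : V) : tensorSq A (v ⊗ₜ w) = A v ⊗ₜ A w := by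
  simp [tensorSq]

variable (V W) in
/-- The linear map `B ↦ tensorLift B`. -/
noncomputable def tensorLiftL [FiniteDimensional ℝ W] :
    (V →L[ℝ] V →L[ℝ] W) →L[ℝ] (V ⊗[ℝ] V →L[ℝ] W) :=
  LinearMap.toContinuousLinearMap
    { toFun := tensorLift
      map_add' := fun B C => by
        ext z
        induction z with
        | zero => simp
        | tmul v w => simp [tensorLift_tmul]
        | add y z hy hz => simp only [map_add, hy, hz]
      map_smul' := fun c B => by
        ext z
        induction z with
        | zero => simp
        | tmul v w => simp [tensorLift_tmul]
        | add y z hy hz => simp only [map_add, hy, hz] }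

variable (V W) in
/-- The bilinear map whose value at `(A, A)` is `tensorSq A`. -/
noncomputable def tensorSqL [FiniteDimensional ℝ W] :
    (V →L[ℝ] W) →L[ℝ] (V →L[ℝ] W) →L[ℝ] (V ⊗[ℝ] V →L[ℝ] W ⊗[ℝ] W) :=
  LinearMap.toContinuousBilinearMap
    (LinearMap.mk₂ ℝ
      (fun A B => LinearMap.toContinuousLinearMap
        (TensorProduct.map A.toLinearMap B.toLinearMap))
      (fun A A' B => by ext z; simp [TensorProduct.map_add_left])
      (fun c A B => by ext z; simp [TensorProduct.map_smul_left])
      (fun A B B' => by ext z; simp [TensorProduct.map_add_right])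
      (fun c A B => by ext z; simp [TensorProduct.map_smul_right]))

lemma tensorSqL_self [FiniteDimensional ℝ W] (A : V →L[ℝ] W) :
    tensorSqL V W A A = tensorSq A := rfl

/-- For the lift of a path, a symmetric bilinear map sees of the second level only the square of the
first: the Riemann sums with left tags and with right tags add up to a telescoping sum. -/
lemma IsCanonicalLift.tensorLift_snd {T : ℝ} {x : ℝ → V} {X : TwoLevel V}
    (hX : IsCanonicalLift T x X) {B : V →L[ℝ] V →L[ℝ] W} (hB : ∀ v w, B v w = B w v) {s t : ℝ}
    (hs : 0 ≤ s) (hst : s ≤ t) (ht : t ≤ T) :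
    tensorLift B (X.snd s t) = (1 / 2 : ℝ) • B (X.fst s t) (X.fst s t) := by
  have hI := (hX.snd_eq s t hs hst ht).clm_comp (tensorLift B)
  set I := tensorLift B (X.snd s t)
  rw [hX.fst_eq s t hs hst ht]
  suffices h : B (x t - x s) (x t - x s) = (2 : ℝ) • I by
    rw [h, smul_smul]
    norm_num
  by_contra hne
  have hpos : 0 < ‖B (x t - x s) (x t - x s) - (2 : ℝ) • I‖ := norm_pos_iff.2 (sub_ne_zero.2 hne)
  obtain ⟨δ, hδ, H⟩ := hI _ (half_pos hpos)
  obtain ⟨n, hn⟩ := (eventually_uniform_mesh hst hδ).exists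
  set D := Partition.uniform hst n
  have h1 := H D D.pts (fun i _ => hn i) fun i _ => left_mem_Icc.2 (D.mono (Nat.le_succ i))
  have h2 := H D (fun i => D.pts (i + 1)) (fun i _ => hn i)
    fun i _ => right_mem_Icc.2 (D.mono (Nat.le_succ i))
  have hterm : ∀ u v, ((tensorLift B).comp (TensorProduct.mkL ℝ V V (x u - x s))) v =
      B (x u - x s) v := fun u v => by
    rw [ContinuousLinearMap.comp_apply, TensorProduct.mkL_apply_apply, tensorLift_tmul]
  simp only [hterm] at h1 h2
  have hsum : ∑ i ∈ Finset.range D.n,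
        B (x (D.pts i) - x s) (increment x (D.pts i) (D.pts (i + 1))) +
      ∑ i ∈ Finset.range D.n,
        B (x (D.pts (i + 1)) - x s) (increment x (D.pts i) (D.pts (i + 1))) =
      B (x t - x s) (x t - x s) := by
    have htel := Finset.sum_range_sub (fun i => B (x (D.pts i) - x s) (x (D.pts i) - x s)) D.n
    simp only [D.left, D.right, sub_self, map_zero, sub_zero] at htel
    rw [← Finset.sum_add_distrib, ← htel]
    refine Finset.sum_congr rfl fun i _ => ?_
    rw [increment, ← sub_sub_sub_cancel_right (x (D.pts (i + 1))) (x (D.pts i)) (x s)]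
    simp only [map_sub, sub_apply]
    rw [hB (x (D.pts i)) (x (D.pts (i + 1))), hB (x (D.pts i)) (x s),
      hB (x (D.pts (i + 1))) (x s)]
    abel
  have h3 := norm_add_le _ _ |>.trans_lt (add_lt_add h1 h2)
  rw [sub_add_sub_comm, hsum, ← two_smul ℝ I, add_halves] at h3
  exact lt_irrefl _ h3

lemma ofReal_norm_le_variation_rpow {G : Type*} [NormedAddCommGroup G] {r T : ℝ} (hr : 0 < r)
    (g : ℝ → ℝ → G) {s t : ℝ} (hs : 0 ≤ s) (hst : s ≤ t) (ht : t ≤ T) :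
    ENNReal.ofReal ‖g s t‖ ≤ variation r g 0 T ^ (1 / r) := by
  calc ENNReal.ofReal ‖g s t‖ = ENNReal.ofReal (‖g s t‖ ^ r) ^ (1 / r) := by
        rw [ENNReal.ofReal_rpow_of_nonneg (by positivity) (by positivity),
          ← Real.rpow_mul (norm_nonneg _), mul_one_div_cancel hr.ne', Real.rpow_one]
    _ ≤ variation r g 0 T ^ (1 / r) := ENNReal.rpow_le_rpow
        ((ofReal_norm_rpow_le_variation hst r g).trans (variation_mono hs hst ht r g))
        (by positivity)

/-- Geometric rough paths inherit the symmetry of the lifts of paths, since convergence in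
`p`-variation distance implies pointwise convergence. -/
lemma IsGeometric.tensorLift_snd {p T : ℝ} (hp : 0 < p) {X : TwoLevel V} (hX : IsGeometric p T X)
    {B : V →L[ℝ] V →L[ℝ] W} (hB : ∀ v w, B v w = B w v) {s t : ℝ}
    (hs : 0 ≤ s) (hst : s ≤ t) (ht : t ≤ T) :
    tensorLift B (X.snd s t) = (1 / 2 : ℝ) • B (X.fst s t) (X.fst s t) := by
  obtain ⟨-, x, Xn, hXn, hlim⟩ := hX
  have h1 : Tendsto (fun n => (Xn n).fst s t) atTop (𝓝 (X.fst s t)) := by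
    rw [tendsto_iff_edist_tendsto_0]
    refine tendsto_of_tendsto_of_tendsto_of_le_of_le tendsto_const_nhds hlim
      (fun _ => zero_le) fun n => ?_
    rw [edist_eq_enorm_sub, ← ofReal_norm]
    exact (ofReal_norm_le_variation_rpow hp (fun s t => (Xn n).fst s t - X.fst s t) hs hst
      ht).trans le_self_add
  have h2 : Tendsto (fun n => (Xn n).snd s t) atTop (𝓝 (X.snd s t)) := by
    rw [tendsto_iff_edist_tendsto_0]
    refine tendsto_of_tendsto_of_tendsto_of_le_of_le tendsto_const_nhds hlim
      (fun _ => zero_le) fun n => ?_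
    rw [edist_eq_enorm_sub, ← ofReal_norm]
    have := ofReal_norm_le_variation_rpow (half_pos hp)
      (fun s t => (Xn n).snd s t - X.snd s t) hs hst ht
    rw [one_div_div] at this
    exact this.trans le_add_self
  have h3 := ((tensorLift B).continuous.tendsto _).comp h2
  have h4 : Tendsto (fun n => (1 / 2 : ℝ) • B ((Xn n).fst s t) ((Xn n).fst s t)) atTop
      (𝓝 ((1 / 2 : ℝ) • B (X.fst s t) (X.fst s t))) :=
    ((by fun_prop : Continuous fun v => (1 / 2 : ℝ) • B v v).tendsto _).comp h1
  refine tendsto_nhds_unique h3 (h4.congr fun n => ?_)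
  exact ((hXn n).tensorLift_snd hB hs hst ht).symm

end Tensor

/-! ### Rough paths and rough integrals from paths -/

section Rough

variable {V W : Type*} [NormedAddCommGroup V] [InnerProductSpace ℝ V]
  [NormedAddCommGroup W] [InnerProductSpace ℝ W] {p T : ℝ} {τ : ℝ → ℝ}

lemma continuousOn_simplex_fst {G : Type*} [TopologicalSpace G] {y : ℝ → G}
    (hy : ContinuousOn y (Icc 0 T)) : ContinuousOn (fun z : ℝ × ℝ => y z.1) (simplex T) :=
  hy.comp continuousOn_fst fun _ hz => ⟨hz.1, hz.2.1.trans hz.2.2⟩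

lemma continuousOn_simplex_snd {G : Type*} [TopologicalSpace G] {y : ℝ → G}
    (hy : ContinuousOn y (Icc 0 T)) : ContinuousOn (fun z : ℝ × ℝ => y z.2) (simplex T) :=
  hy.comp continuousOn_snd fun _ hz => ⟨hz.1.trans hz.2.1, hz.2.2⟩

lemma IsRoughPath.fst_eq {X : TwoLevel V} (hX : IsRoughPath p T X) {s t : ℝ} (hs : 0 ≤ s)
    (hst : s ≤ t) (ht : t ≤ T) : X.fst s t = X.path t - X.path s := by
  rw [TwoLevel.path, TwoLevel.path, hX.chen_fst 0 s t le_rfl hs hst ht, add_sub_cancel_left]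

lemma IsRoughPath.snd_diag {X : TwoLevel V} (hX : IsRoughPath p T X) {t : ℝ} (h0 : 0 ≤ t)
    (ht : t ≤ T) : X.snd t t = 0 := by
  have h := hX.chen_snd t t t h0 le_rfl le_rfl ht
  rw [hX.fst_eq h0 le_rfl ht, sub_self, TensorProduct.zero_tmul, add_zero] at h
  simpa using h

/-- The two-level function `(m_t - m_s, N_t - N_s - m_s ⊗ (m_t - m_s))`. It satisfies Chen's
identity whatever the paths `m` and `N`. -/
noncomputable def TwoLevel.ofPaths (m : ℝ → W) (N : ℝ → W ⊗[ℝ] W) : TwoLevel W where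
  fst := fun s t => m t - m s
  snd := fun s t => N t - N s - m s ⊗ₜ[ℝ] (m t - m s)

lemma isRoughPath_ofPaths (hp : 0 < p) (hτ : IsClock T τ) {m : ℝ → W} {N : ℝ → W ⊗[ℝ] W}
    (hm : ContinuousOn m (Icc 0 T)) (hN : ContinuousOn N (Icc 0 T))
    (h1 : OfOrder (simplex T) (gap τ) (1 / p) fun z => m z.2 - m z.1)
    (h2 : OfOrder (simplex T) (gap τ) (1 / p * 2)
      fun z => N z.2 - N z.1 - m z.1 ⊗ₜ[ℝ] (m z.2 - m z.1)) :
    IsRoughPath p T (TwoLevel.ofPaths m N) where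
  continuousOn_fst := (continuousOn_simplex_snd hm).sub (continuousOn_simplex_fst hm)
  continuousOn_snd := ((continuousOn_simplex_snd hN).sub (continuousOn_simplex_fst hN)).sub
    (TensorProduct.continuous_tmul.comp_continuousOn ((continuousOn_simplex_fst hm).prodMk
      ((continuousOn_simplex_snd hm).sub (continuousOn_simplex_fst hm))))
  chen_fst := fun s u t _ _ _ _ => by simp only [TwoLevel.ofPaths]; abel
  chen_snd := fun s u t _ _ _ _ => by
    simp only [TwoLevel.ofPaths, TensorProduct.tmul_sub, TensorProduct.sub_tmul]
    abel
  variation_fst := h1.variation_ne_top hτ hp (g := fun s t => m t - m s) le_rfl le_rfl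
  variation_snd := by
    rw [show 1 / p * 2 = 1 / (p / 2) by field_simp] at h2
    exact h2.variation_ne_top hτ (half_pos hp)
      (g := fun s t => N t - N s - m s ⊗ₜ[ℝ] (m t - m s)) le_rfl le_rfl

variable [FiniteDimensional ℝ V] {θ : ℝ} {f : V → V →L[ℝ] W} {X : TwoLevel V} {Y Y' : TwoLevel W}

/-- A rough path that differs from the germ of the one-form by terms of order `θ > 1` is the rough
integral; the constants are absorbed by rescaling the control. -/
lemma isRoughIntegral_of_order (hτ : IsClock T τ) (hθ : 1 < θ) (hY : IsRoughPath p T Y)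
    (h1 : OfOrder (simplex T) (gap τ) θ fun z => Y.fst z.1 z.2 - (almostIntegral f X).fst z.1 z.2)
    (h2 : OfOrder (simplex T) (gap τ) θ
      fun z => Y.snd z.1 z.2 - (almostIntegral f X).snd z.1 z.2) :
    IsRoughIntegral p T f X Y := by
  obtain ⟨C₁, hC₁, h1⟩ := h1
  obtain ⟨C₂, hC₂, h2⟩ := h2
  set c := (C₁ + C₂) ^ (1 / θ)
  have hc : 0 ≤ c := by positivity
  have hcθ : c ^ θ = C₁ + C₂ := by
    rw [← Real.rpow_mul (by positivity), one_div_mul_cancel (by linarith), Real.rpow_one]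
  refine ⟨hY, fun s t => c * (τ t - τ s), θ, ⟨fun s t hs hst ht => ?_, ?_, ?_, ?_⟩, hθ,
    fun s t hs hst ht => ?_⟩
  · exact mul_nonneg hc (hτ.sub_nonneg hs hst ht)
  · exact ((continuousOn_simplex_snd hτ.continuousOn).sub
      (continuousOn_simplex_fst hτ.continuousOn)).const_smul c
  · intro s u t _ _ _ _
    exact le_of_eq (by ring)
  · intro t _ _
    ring
  · have h0 := hτ.sub_nonneg hs hst ht
    rw [Real.mul_rpow hc h0, hcθ, add_mul]
    have g1 := h1 (s, t) ⟨hs, hst, ht⟩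
    have g2 := h2 (s, t) ⟨hs, hst, ht⟩
    simp only [gap] at g1 g2
    have := Real.rpow_nonneg h0 θ
    constructor <;> nlinarith

/-- A control is dominated by a clock, its value from time `0`. -/
lemma IsControl.isClock {ω : ℝ → ℝ → ℝ} (hω : IsControl T ω) : IsClock T (ω 0) where
  monotoneOn := fun s hs t ht hst => by
    linarith [hω.superadditive 0 s t le_rfl hs.1 hst ht.2, hω.nonneg s t hs.1 hst ht.2]
  continuousOn := hω.continuousOn.comp (f := fun t : ℝ => ((0 : ℝ), t)) (by fun_prop)
    fun t ht => ⟨le_rfl, ht.1, ht.2⟩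

lemma IsControl.ofOrder {G : Type*} [NormedAddCommGroup G] {ω : ℝ → ℝ → ℝ} (hω : IsControl T ω)
    (hθ : 0 ≤ θ) {g : ℝ → ℝ → G}
    (hg : ∀ s t, 0 ≤ s → s ≤ t → t ≤ T → ‖g s t‖ ≤ ω s t ^ θ) :
    OfOrder (simplex T) (gap (ω 0)) θ fun z => g z.1 z.2 := by
  refine ⟨1, zero_le_one, fun z hz => ?_⟩
  obtain ⟨h1, h2, h3⟩ := hz
  rw [one_mul]
  refine (hg _ _ h1 h2 h3).trans (Real.rpow_le_rpow (hω.nonneg _ _ h1 h2 h3) ?_ hθ)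
  simp only [gap]
  linarith [hω.superadditive 0 z.1 z.2 le_rfl h1 h2 h3]

lemma OfOrder.clock_mono {G : Type*} [NormedAddCommGroup G] {σ : ℝ → ℝ} {a : ℝ} (ha : 0 ≤ a)
    (hτ : IsClock T τ) (hle : ∀ z ∈ simplex T, gap τ z ≤ gap σ z) {g : ℝ × ℝ → G}
    (hg : OfOrder (simplex T) (gap τ) a g) : OfOrder (simplex T) (gap σ) a g := by
  obtain ⟨C, hC, h⟩ := hg
  exact ⟨C, hC, fun z hz => (h z hz).trans (mul_le_mul_of_nonneg_left
    (Real.rpow_le_rpow (hτ.gap_nonneg hz) (hle z hz) ha) hC)⟩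

lemma OfOrder.clock_add_right {G : Type*} [NormedAddCommGroup G] {σ : ℝ → ℝ} {a : ℝ} (ha : 0 ≤ a)
    (hτ : IsClock T τ) (hσ : IsClock T σ) {g : ℝ × ℝ → G}
    (hg : OfOrder (simplex T) (gap τ) a g) :
    OfOrder (simplex T) (gap fun t => τ t + σ t) a g :=
  hg.clock_mono ha hτ fun z hz => by
    have := hσ.gap_nonneg hz
    simp only [gap] at this ⊢
    linarith

lemma OfOrder.clock_add_left {G : Type*} [NormedAddCommGroup G] {σ : ℝ → ℝ} {a : ℝ} (ha : 0 ≤ a)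
    (hτ : IsClock T τ) (hσ : IsClock T σ) {g : ℝ × ℝ → G}
    (hg : OfOrder (simplex T) (gap σ) a g) :
    OfOrder (simplex T) (gap fun t => τ t + σ t) a g := by
  simpa only [add_comm] using hg.clock_add_right ha hσ hτ

/-- The rough integral is unique on the simplex: the difference of the first levels is additive, and
once these agree so is the difference of the second levels. -/
lemma IsRoughIntegral.unique (h : IsRoughIntegral p T f X Y) (h' : IsRoughIntegral p T f X Y')
    {s t : ℝ} (hs : 0 ≤ s) (hst : s ≤ t) (ht : t ≤ T) :
    Y.fst s t = Y'.fst s t ∧ Y.snd s t = Y'.snd s t := by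
  obtain ⟨hY, ω, θ, hω, hθ, hb⟩ := h
  obtain ⟨hY', ω', θ', hω', hθ', hb'⟩ := h'
  have hτ := hω.isClock.add hω'.isClock
  have hmin : 1 < min θ θ' := lt_min hθ hθ'
  have key : ∀ {G : Type _} [NormedAddCommGroup G] {g g' A : ℝ → ℝ → G},
      (∀ s t, 0 ≤ s → s ≤ t → t ≤ T → ‖g s t - A s t‖ ≤ ω s t ^ θ) →
      (∀ s t, 0 ≤ s → s ≤ t → t ≤ T → ‖g' s t - A s t‖ ≤ ω' s t ^ θ') →
      (∀ s u t, 0 ≤ s → s ≤ u → u ≤ t → t ≤ T →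
        g s t - g' s t = (g s u - g' s u) + (g u t - g' u t)) →
      ∀ s t, 0 ≤ s → s ≤ t → t ≤ T → g s t = g' s t := by
    intro G _ g g' A hg hg' hadd s t hs hst ht
    have o1 := ((hω.ofOrder (by linarith) hg).clock_add_right (by linarith) hω.isClock
      hω'.isClock).mono hτ.isGauge (by linarith) (min_le_left θ θ')
    have o2 := ((hω'.ofOrder (by linarith) hg').clock_add_left (by linarith) hω.isClock
      hω'.isClock).mono hτ.isGauge (by linarith) (min_le_right θ θ')
    obtain ⟨C, -, hC⟩ := o1.sub o2
    refine sub_eq_zero.1 (eq_of_additive_of_le hτ hmin (g := fun s t => g s t - g' s t) (C := C)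
      hadd (fun s t hs hst ht => ?_) hs hst ht)
    have := hC (s, t) ⟨hs, hst, ht⟩
    simp only [sub_sub_sub_cancel_right] at this
    exact this
  have e1 := key (fun s t h1 h2 h3 => (hb s t h1 h2 h3).1)
    (fun s t h1 h2 h3 => (hb' s t h1 h2 h3).1) fun s u t h1 h2 h3 h4 => by
      rw [hY.chen_fst s u t h1 h2 h3 h4, hY'.chen_fst s u t h1 h2 h3 h4]
      abel
  have e2 := key (fun s t h1 h2 h3 => (hb s t h1 h2 h3).2)
    (fun s t h1 h2 h3 => (hb' s t h1 h2 h3).2) fun s u t h1 h2 h3 h4 => by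
      rw [hY.chen_snd s u t h1 h2 h3 h4, hY'.chen_snd s u t h1 h2 h3 h4,
        e1 s u h1 h2 (h3.trans h4), e1 u t (h1.trans h2) h3 h4]
      abel
  exact ⟨e1 s t hs hst ht, e2 s t hs hst ht⟩

lemma IsRoughIntegral.isRoughIntegral_roughIntegral (h : IsRoughIntegral p T f X Y) :
    IsRoughIntegral p T f X (roughIntegral p T f X) := by
  have hex : ∃ Y : TwoLevel W, IsRoughIntegral p T f X Y := ⟨Y, h⟩
  rw [roughIntegral, dif_pos hex]
  exact hex.choose_spec

end Rough

/-! ### The Itô type formula -/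

section Ito

variable {V W : Type*} [NormedAddCommGroup V] [InnerProductSpace ℝ V]
  [NormedAddCommGroup W] [InnerProductSpace ℝ W] {p T : ℝ} {τ : ℝ → ℝ}

/-- One clock controls both levels of a rough path and the perturbation. -/
lemma IsRoughPath.exists_clock (hp : 0 < p) {X : TwoLevel V} (hX : IsRoughPath p T X)
    {φ : ℝ → V ⊗[ℝ] V} (hφc : ContinuousOn φ (Icc 0 T))
    (hφ : variation (p / 2) (increment φ) 0 T ≠ ∞) :
    ∃ τ : ℝ → ℝ, IsClock T τ ∧
      OfOrder (simplex T) (gap τ) (1 / p) (fun z => X.path z.2 - X.path z.1) ∧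
      OfOrder (simplex T) (gap τ) (1 / p * 2) (fun z => X.snd z.1 z.2) ∧
      OfOrder (simplex T) (gap τ) (1 / p * 2) (fun z => φ z.2 - φ z.1) := by
  have e : 1 / p * 2 = 1 / (p / 2) := by field_simp
  obtain ⟨τ₁, h₁, b₁⟩ := RoughIto.exists_clock hp hX.continuousOn_fst
    (fun t h0 ht => by rw [hX.fst_eq h0 le_rfl ht, sub_self]) hX.variation_fst
  obtain ⟨τ₂, h₂, b₂⟩ := RoughIto.exists_clock (half_pos hp) hX.continuousOn_snd
    (fun t h0 ht => hX.snd_diag h0 ht) hX.variation_snd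
  obtain ⟨τ₃, h₃, b₃⟩ := RoughIto.exists_clock (half_pos hp) (g := increment φ)
    ((continuousOn_simplex_snd hφc).sub (continuousOn_simplex_fst hφc))
    (fun t _ _ => sub_self _) hφ
  have hp' : 0 ≤ 1 / p := by positivity
  have hp2 : 0 ≤ 1 / (p / 2) := by positivity
  refine ⟨fun t => (τ₁ t + τ₂ t) + τ₃ t, (h₁.add h₂).add h₃, ?_, ?_, ?_⟩
  · refine OfOrder.congr (((OfOrder.of_rpow_le hp b₁).clock_add_right hp' h₁ h₂).clock_add_right
      hp' (h₁.add h₂) h₃) fun z hz => (hX.fst_eq hz.1 hz.2.1 hz.2.2).symm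
  · rw [e]
    exact ((OfOrder.of_rpow_le (half_pos hp) b₂).clock_add_left hp2 h₁ h₂).clock_add_right
      hp2 (h₁.add h₂) h₃
  · rw [e]
    exact (OfOrder.of_rpow_le (half_pos hp) b₃).clock_add_left hp2 (h₁.add h₂) h₃

lemma IsRoughPath.perturb (hp : 0 < p) (hτ : IsClock T τ) {X : TwoLevel V} (hX : IsRoughPath p T X)
    {φ : ℝ → V ⊗[ℝ] V} (hφc : ContinuousOn φ (Icc 0 T))
    (hX2 : OfOrder (simplex T) (gap τ) (1 / p * 2) fun z => X.snd z.1 z.2)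
    (hφ : OfOrder (simplex T) (gap τ) (1 / p * 2) fun z => φ z.2 - φ z.1) :
    IsRoughPath p T (X.perturb φ) where
  continuousOn_fst := hX.continuousOn_fst
  continuousOn_snd := hX.continuousOn_snd.sub
    ((continuousOn_simplex_snd hφc).sub (continuousOn_simplex_fst hφc))
  chen_fst := hX.chen_fst
  chen_snd := fun s u t h1 h2 h3 h4 => by
    simp only [TwoLevel.perturb, increment]
    rw [hX.chen_snd s u t h1 h2 h3 h4]
    abel
  variation_fst := hX.variation_fst
  variation_snd := by
    have h := hX2.sub hφ
    rw [show 1 / p * 2 = 1 / (p / 2) by field_simp] at h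
    exact h.variation_ne_top hτ (half_pos hp)
      (g := fun s t => X.snd s t - (φ t - φ s)) le_rfl le_rfl

lemma OfOrder.of_continuousOn {G : Type*} [NormedAddCommGroup G] {y : ℝ → G}
    (hy : ContinuousOn y (Icc 0 T)) :
    OfOrder (simplex T) (gap τ) 0 (fun z => y z.1) ∧
      OfOrder (simplex T) (gap τ) 0 (fun z => y z.2) := by
  obtain ⟨C, hC⟩ := isCompact_Icc.exists_bound_of_continuousOn hy
  exact ⟨OfOrder.of_bound fun z hz => hC _ ⟨hz.1, hz.2.1.trans hz.2.2⟩,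
    OfOrder.of_bound fun z hz => hC _ ⟨hz.1.trans hz.2.1, hz.2.2⟩⟩

variable [FiniteDimensional ℝ V] [FiniteDimensional ℝ W]

/-- The second level of the rough integral, obtained by sewing the germ
`(g_s ⊗ g_s) X²_{s,t} + f_s ⊗ (f_t - f_s)`. Chen's identity for `X` makes this germ almost additive
because `f_t - f_s` agrees with `g_s (x_t - x_s)` to first order. -/
lemma exists_second_level (hT : 0 ≤ T) (hτ : IsClock T τ) {X : TwoLevel V}
    (hX : IsRoughPath p T X) {α θ : ℝ} (hα : 0 ≤ α) (hθ : 1 < θ) (hθα : θ ≤ α + α * 2)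
    {f : ℝ → W} {g : ℝ → V →L[ℝ] W}
    (hx : OfOrder (simplex T) (gap τ) α fun z => X.path z.2 - X.path z.1)
    (hX2 : OfOrder (simplex T) (gap τ) (α * 2) fun z => X.snd z.1 z.2)
    (hf : OfOrder (simplex T) (gap τ) α fun z => f z.2 - f z.1)
    (hg0 : OfOrder (simplex T) (gap τ) 0 fun z => g z.1)
    (hg : OfOrder (simplex T) (gap τ) α fun z => g z.2 - g z.1)
    (hsq : OfOrder (simplex T) (gap τ) α fun z => tensorSq (g z.2) - tensorSq (g z.1))
    (hfg : OfOrder (simplex T) (gap τ) (α * 2)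
      fun z => f z.2 - f z.1 - g z.1 (X.path z.2 - X.path z.1)) :
    ∃ N : ℝ → W ⊗[ℝ] W, OfOrder (simplex T) (gap τ) θ fun z =>
      N z.2 - N z.1 - f z.1 ⊗ₜ[ℝ] (f z.2 - f z.1) - tensorSq (g z.1) (X.snd z.1 z.2) := by
  have hα2 : 0 ≤ α * 2 := by linarith
  have hρ := hτ.isGauge₃
  have hgx : OfOrder (simplex T) (gap τ) α fun z => g z.1 (X.path z.2 - X.path z.1) := by
    simpa only [zero_add] using hg0.clm_apply hτ.isGauge le_rfl hα hx
  have t1 := (hsq.restrict_left hτ hα).clm_apply hρ hα hα2 (hX2.restrict_right hτ hα2)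
  have t2 := (hfg.restrict_left hτ hα2).bilin hρ hα2 hα (TensorProduct.mkL ℝ W W)
    (hf.restrict_right hτ hα)
  have t3 := (hgx.restrict_left hτ hα).bilin hρ hα hα2 (TensorProduct.mkL ℝ W W)
    (hfg.restrict_right hτ hα2)
  have t4 := (hgx.restrict_left hτ hα).bilin hρ hα (add_nonneg hα hα) (TensorProduct.mkL ℝ W W)
    ((hg.restrict_left hτ hα).clm_apply hρ hα hα (hx.restrict_right hτ hα))
  rw [← mul_two] at t4
  rw [add_comm] at t2
  obtain ⟨N, hN⟩ := exists_sewing hT hτ hθ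
    (A := fun s t => tensorSq (g s) (X.snd s t) + f s ⊗ₜ[ℝ] (f t - f s)) (by
      refine OfOrder.congr ((((t1.add t2).add t3).add t4).neg.mono hρ (by linarith) hθα)
        fun z hz => ?_
      obtain ⟨h1, h2, h3, h4⟩ := hz
      rw [hX.chen_snd z.1 z.2.1 z.2.2 h1 h2 h3 h4, hX.fst_eq h1 h2 (h3.trans h4),
        hX.fst_eq (h1.trans h2) h3 h4, map_add, map_add, tensorSq_tmul]
      simp only [TensorProduct.mkL_apply_apply, map_sub, sub_apply, TensorProduct.tmul_sub,
        TensorProduct.sub_tmul]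
      abel)
  exact ⟨N, hN.congr fun z _ => by abel⟩

set_option maxHeartbeats 400000 in
/-- The Itô type formula for abstract paths: `f` plays the role of `F(X)`, the one-form `ψ` that of
`DF`, and `g`, `h` are the paths `ψ(X)` and `Dψ(X)`. Only the orders of their increments and the
second-order expansion of `f` along `X` matter. The rough integral along `X` is
`TwoLevel.ofPaths f N₀`. The one along the perturbation is `TwoLevel.ofPaths (f - J) N` with
`J = ∫ h dφ`, and the product `(f - J)_s ⊗ (f - J)_{s,t}` in its second level yields the mixed
integrals of the formula. -/
theorem ito_formula_of_order (hp : 0 < p) (hT : 0 ≤ T) (hτ : IsClock T τ) {X : TwoLevel V}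
    (hX : IsRoughPath p T X) {φ : ℝ → V ⊗[ℝ] V} {κ : ℝ}
    (hκ : 0 < κ) (hκ1 : κ ≤ 1) (hα2 : 1 / p * 2 ≤ 1) (hθ : 1 < 1 / p * κ + 1 / p * 2)
    {f : ℝ → W} {ψ : V → V →L[ℝ] W} {g : ℝ → V →L[ℝ] W} {h : ℝ → V ⊗[ℝ] V →L[ℝ] W}
    (hgψ : ∀ u, ψ (X.path u) = g u) (hhψ : ∀ u, tensorLift (fderiv ℝ ψ (X.path u)) = h u)
    (hx : OfOrder (simplex T) (gap τ) (1 / p) fun z => X.path z.2 - X.path z.1)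
    (hX2 : OfOrder (simplex T) (gap τ) (1 / p * 2) fun z => X.snd z.1 z.2)
    (hφo : OfOrder (simplex T) (gap τ) (1 / p * 2) fun z => φ z.2 - φ z.1)
    (hfo : OfOrder (simplex T) (gap τ) (1 / p) fun z => f z.2 - f z.1)
    (hgo : OfOrder (simplex T) (gap τ) (1 / p) fun z => g z.2 - g z.1)
    (hho : OfOrder (simplex T) (gap τ) (1 / p * κ) fun z => h z.2 - h z.1)
    (htay1 : OfOrder (simplex T) (gap τ) (1 / p * 2)
      fun z => f z.2 - f z.1 - g z.1 (X.path z.2 - X.path z.1))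
    (htay2 : OfOrder (simplex T) (gap τ) (1 / p * κ + 1 / p * 2)
      fun z => f z.2 - f z.1 - g z.1 (X.path z.2 - X.path z.1) - h z.1 (X.snd z.1 z.2)) :
    IsRoughIntegral p T ψ X (roughIntegral p T ψ X) ∧
    IsRoughIntegral p T ψ (X.perturb φ) (roughIntegral p T ψ (X.perturb φ)) ∧
    ∀ s t : ℝ, 0 ≤ s → s ≤ t → t ≤ T →
      (roughIntegral p T ψ X).fst s t = f t - f s ∧
      YoungIntegrable h φ s t ∧
      f t - f s = (roughIntegral p T ψ (X.perturb φ)).fst s t + youngIntegral h φ s t ∧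
      YoungIntegrable (fun u => tensorSq (g u)) φ s t ∧
      YoungIntegrable (fun u => TensorProduct.mkL ℝ W W (youngIntegral h φ s u)) f s t ∧
      YoungIntegrable (fun u => (TensorProduct.mkL ℝ W W (f u - f s)).comp (h u)) φ s t ∧
      YoungIntegrable (fun u => (TensorProduct.mkL ℝ W W (youngIntegral h φ s u)).comp (h u))
        φ s t ∧
      (roughIntegral p T ψ X).snd s t =
        (roughIntegral p T ψ (X.perturb φ)).snd s t +
        youngIntegral (fun u => tensorSq (g u)) φ s t +
        youngIntegral (fun u => TensorProduct.mkL ℝ W W (youngIntegral h φ s u)) f s t +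
        youngIntegral (fun u => (TensorProduct.mkL ℝ W W (f u - f s)).comp (h u)) φ s t -
        youngIntegral (fun u => (TensorProduct.mkL ℝ W W (youngIntegral h φ s u)).comp (h u))
          φ s t := by
  have hpα : 0 < 1 / p := by positivity
  set α := 1 / p with hαdef
  set θ := α * κ + α * 2 with hθdef
  have hακ : 0 < α * κ := by positivity
  have hακα : α * κ ≤ α := by nlinarith
  have hα20 : 0 < α * 2 := by positivity
  have hρ := hτ.isGauge
  have hθ3 : θ ≤ α + α * 2 := by rw [hθdef]; linarith
  have hfc := hfo.continuousOn hτ hpα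
  have hgc := hgo.continuousOn hτ hpα
  have hhc := hho.continuousOn hτ hακ
  have hf0 := (OfOrder.of_continuousOn (τ := τ) hfc).1
  have hsq : OfOrder (simplex T) (gap τ) α fun z => tensorSq (g z.2) - tensorSq (g z.1) :=
    (OfOrder.bilin_increment hτ hpα.le (tensorSqL V W) (OfOrder.of_continuousOn hgc).2
      (OfOrder.of_continuousOn hgc).1 hgo hgo).congr fun z _ => by
        rw [tensorSqL_self, tensorSqL_self]
  have hsqc := hsq.continuousOn (z := fun u => tensorSq (g u)) hτ hpα
  have hsq' := hsq.mono hρ hακ.le hακα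
  -- The second level of the rough integral along `X`, and the Young integrals.
  obtain ⟨N₀, hN₀⟩ := exists_second_level hT hτ hX hpα.le hθ hθ3 hx hX2 hfo
    (OfOrder.of_continuousOn hgc).1 hgo hsq htay1
  obtain ⟨J, hJ, hJi⟩ := exists_young hT hτ hακ.le hα20.le hθ hho hφo
  have hhφ : OfOrder (simplex T) (gap τ) (α * 2) fun z => h z.1 (φ z.2 - φ z.1) := by
    simpa only [zero_add] using
      (OfOrder.of_continuousOn hhc).1.clm_apply hρ le_rfl hα20.le hφo
  have hJo : OfOrder (simplex T) (gap τ) (α * 2) fun z => J z.2 - J z.1 :=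
    ((hJ.mono hρ hα20.le (by linarith)).add hhφ).congr fun z _ => by abel
  have hJc := hJo.continuousOn hτ hα20
  have hJ0 := (OfOrder.of_continuousOn (τ := τ) hJc).1
  obtain ⟨E, hE, hEi⟩ := exists_young (Y := fun u => tensorSq (g u)) hT hτ hακ.le hα20.le hθ
    hsq' hφo
  have hmk : ∀ y : ℝ → W, OfOrder (simplex T) (gap τ) (α * 2) (fun z => y z.2 - y z.1) →
      OfOrder (simplex T) (gap τ) (α * 2)
        fun z => TensorProduct.mkL ℝ W W (y z.2) - TensorProduct.mkL ℝ W W (y z.1) :=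
    fun y hy => (hy.clm (TensorProduct.mkL ℝ W W)).congr fun z _ => (map_sub _ _ _).symm
  obtain ⟨P, hP, hPi⟩ := exists_young (Y := fun u => TensorProduct.mkL ℝ W W (J u)) hT hτ
    hα20.le hpα.le (by linarith) (hmk J hJo) hfo
  replace hP := hP.mono hρ (b := α * 2 + α) (a := θ) (by linarith) (by linarith)
  -- Products of a path of sufficient order with `h`.
  have hprod : ∀ y : ℝ → W, OfOrder (simplex T) (gap τ) (α * κ) (fun z => y z.2 - y z.1) →
      OfOrder (simplex T) (gap τ) (α * κ) fun z =>
        (TensorProduct.mkL ℝ W W (y z.2)).comp (h z.2) -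
          (TensorProduct.mkL ℝ W W (y z.1)).comp (h z.1) := fun y hy =>
    (OfOrder.bilin_increment hτ hακ.le
      ((ContinuousLinearMap.compL ℝ (V ⊗[ℝ] V) W (W ⊗[ℝ] W)).comp (TensorProduct.mkL ℝ W W))
      (OfOrder.of_continuousOn (hy.continuousOn hτ hακ)).2 (OfOrder.of_continuousOn hhc).1 hy
      hho).congr fun z _ => by
        simp only [ContinuousLinearMap.comp_apply, ContinuousLinearMap.compL_apply]
  have hfκ := hfo.mono hρ hακ.le hακα
  have hJκ := hJo.mono hρ hακ.le (by linarith)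
  obtain ⟨Q, hQ, hQi⟩ := exists_young (Y := fun u => (TensorProduct.mkL ℝ W W (f u)).comp (h u))
    hT hτ hακ.le hα20.le hθ (hprod f hfκ) hφo
  obtain ⟨R, hR, hRi⟩ := exists_young (Y := fun u => (TensorProduct.mkL ℝ W W (J u)).comp (h u))
    hT hτ hακ.le hα20.le hθ (hprod J hJκ) hφo
  simp only [ContinuousLinearMap.comp_apply] at hQ hR
  have hfJ := hf0.bilin hρ le_rfl (by linarith : 0 ≤ θ) (TensorProduct.mkL ℝ W W) hJ
  have hJJ := hJ0.bilin hρ le_rfl (by linarith : 0 ≤ θ) (TensorProduct.mkL ℝ W W) hJ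
  rw [zero_add] at hfJ hJJ
  -- The rough integral along `X`.
  have hgX2 : OfOrder (simplex T) (gap τ) (α * 2) fun z => tensorSq (g z.1) (X.snd z.1 z.2) := by
    simpa only [zero_add] using
      (OfOrder.of_continuousOn (y := fun u => tensorSq (g u)) hsqc).1.clm_apply hρ le_rfl hα20.le
        hX2
  have hgφ : OfOrder (simplex T) (gap τ) (α * 2) fun z => tensorSq (g z.1) (φ z.2 - φ z.1) := by
    simpa only [zero_add] using
      (OfOrder.of_continuousOn (y := fun u => tensorSq (g u)) hsqc).1.clm_apply hρ le_rfl hα20.le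
        hφo
  have hff : OfOrder (simplex T) (gap τ) α
      fun z => TensorProduct.mkL ℝ W W (f z.1) (f z.2 - f z.1) := by
    simpa only [zero_add] using hf0.bilin hρ le_rfl hpα.le (TensorProduct.mkL ℝ W W) hfo
  have hN₀c : ContinuousOn N₀ (Icc 0 T) := by
    refine OfOrder.continuousOn hτ hpα ((((hN₀.mono hρ hpα.le (by linarith)).add hff).add
      (hgX2.mono hρ hpα.le (by linarith))).congr fun z _ => ?_)
    rw [TensorProduct.mkL_apply_apply]
    abel
  have hI : IsRoughIntegral p T ψ X (TwoLevel.ofPaths f N₀) := by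
    refine isRoughIntegral_of_order hτ hθ (isRoughPath_ofPaths hp hτ hfc hN₀c hfo
      (((hN₀.mono hρ hα20.le (by linarith)).add hgX2).congr fun z _ => by abel))
      (htay2.congr fun z hz => ?_) (hN₀.congr fun z _ => ?_)
    · simp only [TwoLevel.ofPaths, almostIntegral]
      rw [hgψ, hhψ, hX.fst_eq hz.1 hz.2.1 hz.2.2]
      abel
    · simp only [TwoLevel.ofPaths, almostIntegral]
      rw [hgψ]
  -- The rough integral along the perturbation.
  set m : ℝ → W := fun u => f u - J u with hm
  set N : ℝ → W ⊗[ℝ] W := fun u => N₀ u - E u - P u - Q u + R u with hN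
  have hNg : OfOrder (simplex T) (gap τ) θ fun z => N z.2 - N z.1 - m z.1 ⊗ₜ[ℝ] (m z.2 - m z.1) -
      tensorSq (g z.1) (X.snd z.1 z.2 - (φ z.2 - φ z.1)) := by
    refine ((((((hN₀.sub hE).sub hP).sub hQ).add hR).add hfJ).sub hJJ).congr fun z _ => ?_
    simp only [hm, hN, TensorProduct.mkL_apply_apply, map_sub, TensorProduct.tmul_sub,
      TensorProduct.sub_tmul]
    abel
  have hmo : OfOrder (simplex T) (gap τ) α fun z => m z.2 - m z.1 :=
    (hfo.sub (hJo.mono hρ hpα.le (by linarith))).congr fun z _ => by simp only [hm]; abel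
  have hNc : ContinuousOn N (Icc 0 T) := by
    have hmc := hmo.continuousOn hτ hpα
    have hmm : OfOrder (simplex T) (gap τ) α
        fun z => TensorProduct.mkL ℝ W W (m z.1) (m z.2 - m z.1) := by
      simpa only [zero_add] using (OfOrder.of_continuousOn hmc).1.bilin hρ le_rfl hpα.le
        (TensorProduct.mkL ℝ W W) hmo
    refine OfOrder.continuousOn hτ hpα ((((hNg.mono hρ hpα.le (by linarith)).add hmm).add
      ((hgX2.sub hgφ).mono hρ hpα.le (by linarith))).congr fun z _ => ?_)
    rw [TensorProduct.mkL_apply_apply, map_sub]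
    abel
  have hIφ : IsRoughIntegral p T ψ (X.perturb φ) (TwoLevel.ofPaths m N) := by
    refine isRoughIntegral_of_order hτ hθ (isRoughPath_ofPaths hp hτ (hmo.continuousOn hτ hpα) hNc
      hmo (((hNg.mono hρ hα20.le (by linarith)).add (hgX2.sub hgφ)).congr fun z _ => ?_))
      ((htay2.sub hJ).congr fun z hz => ?_) (hNg.congr fun z _ => ?_)
    · rw [map_sub]
      abel
    · have e1 : (X.perturb φ).path = X.path := rfl
      have e2 : (X.perturb φ).fst = X.fst := rfl
      simp only [TwoLevel.ofPaths, almostIntegral]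
      rw [e1, e2, hgψ, hhψ, hX.fst_eq hz.1 hz.2.1 hz.2.2]
      simp only [TwoLevel.perturb, increment, hm, map_sub]
      abel
    · have e1 : (X.perturb φ).path = X.path := rfl
      simp only [TwoLevel.ofPaths, almostIntegral]
      rw [e1, hgψ]
      rfl
  have hI' := hI.isRoughIntegral_roughIntegral
  have hIφ' := hIφ.isRoughIntegral_roughIntegral
  refine ⟨hI', hIφ', fun s t hs hst ht => ?_⟩
  obtain ⟨u1, u2⟩ := hI'.unique hI hs hst ht
  obtain ⟨v1, v2⟩ := hIφ'.unique hIφ hs hst ht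
  have hκ2 : α * κ ≤ 1 := by linarith
  have hα1 : α ≤ 1 := by linarith
  -- The integrals started at `s`.
  have hJs : ∀ u ∈ Icc s t, youngIntegral h φ s u = J u - J s := fun u hu =>
    (hJi s u hs hu.1 (hu.2.trans ht)).youngIntegral_eq hu.1
  have iJ := hJi s t hs hst ht
  have iE := hEi s t hs hst ht
  have iP : HasStieltjesIntegral (fun u => TensorProduct.mkL ℝ W W (J u - J s)) f s t
      (P t - P s - J s ⊗ₜ[ℝ] (f t - f s)) := by
    have h1 := (hPi s t hs hst ht).sub
      (HasStieltjesIntegral.const (Z := f) (TensorProduct.mkL ℝ W W (J s)))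
    rw [TensorProduct.mkL_apply_apply] at h1
    exact h1.congr fun u _ => map_sub _ _ _
  have hshift : ∀ (y : ℝ → W) (S : ℝ → W ⊗[ℝ] W),
      HasStieltjesIntegral (fun u => (TensorProduct.mkL ℝ W W (y u)).comp (h u)) φ s t (S t - S s) →
      HasStieltjesIntegral (fun u => (TensorProduct.mkL ℝ W W (y u - y s)).comp (h u)) φ s t
        (S t - S s - y s ⊗ₜ[ℝ] (J t - J s)) := by
    intro y S hS
    have h1 := hS.sub (iJ.clm_comp (TensorProduct.mkL ℝ W W (y s)))
    rw [TensorProduct.mkL_apply_apply] at h1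
    refine h1.congr fun u _ => ?_
    rw [map_sub, ContinuousLinearMap.sub_comp]
  have iQ := hshift f Q (hQi s t hs hst ht)
  have iR := hshift J R (hRi s t hs hst ht)
  have cP : ∀ u ∈ Icc s t, TensorProduct.mkL ℝ W W (youngIntegral h φ s u) =
      TensorProduct.mkL ℝ W W (J u - J s) := fun u hu => by rw [hJs u hu]
  have cR : ∀ u ∈ Icc s t, (TensorProduct.mkL ℝ W W (youngIntegral h φ s u)).comp (h u) =
      (TensorProduct.mkL ℝ W W (J u - J s)).comp (h u) := fun u hu => by rw [hJs u hu]
  have hincr : ∀ {a : ℝ} {y : ℝ → W}, OfOrder (simplex T) (gap τ) a (fun z => y z.2 - y z.1) →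
      OfOrder (simplex T) (gap τ) a (fun z => (y z.2 - y s) - (y z.1 - y s)) := fun hy =>
    hy.congr fun z _ => sub_sub_sub_cancel_right _ _ _
  have hθ1 : 1 < α * 2 + α := by linarith
  refine ⟨u1, ?_, ?_, ?_, ?_, ?_, ?_, ?_⟩
  · exact iJ.youngIntegrable hτ hακ hκ2 hα20 hα2 hθ hho hφo hs ht
  · rw [v1, iJ.youngIntegral_eq hst]
    simp only [TwoLevel.ofPaths, hm]
    abel
  · exact iE.youngIntegrable (Y := fun u => tensorSq (g u)) hτ hακ hκ2 hα20 hα2 hθ hsq' hφo hs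
      ht
  · exact (iP.youngIntegrable (Y := fun u => TensorProduct.mkL ℝ W W (J u - J s)) hτ hα20 hα2 hpα
      hα1 hθ1 (hmk (fun u => J u - J s) (hincr hJo)) hfo hs ht).congr cP
  · exact iQ.youngIntegrable (Y := fun u => (TensorProduct.mkL ℝ W W (f u - f s)).comp (h u)) hτ
      hακ hκ2 hα20 hα2 hθ (hprod (fun u => f u - f s) (hincr hfκ)) hφo hs ht
  · exact (iR.youngIntegrable (Y := fun u => (TensorProduct.mkL ℝ W W (J u - J s)).comp (h u)) hτ
      hακ hκ2 hα20 hα2 hθ (hprod (fun u => J u - J s) (hincr hJκ)) hφo hs ht).congr cR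
  · rw [u2, v2, iE.youngIntegral_eq hst, (iP.congr cP).youngIntegral_eq hst,
      iQ.youngIntegral_eq hst, (iR.congr cR).youngIntegral_eq hst]
    simp only [TwoLevel.ofPaths, hm, hN, TensorProduct.tmul_sub, TensorProduct.sub_tmul]
    abel

/-- The orders of the increments of `F`, `DF` and `D²F` along a geometric rough path, and the first-
and second-order expansions of `F`. Geometricity turns the quadratic term of Taylor's formula into
`D²F(X_s) X²_{s,t}`. -/
lemma order_of_taylor (hp : 0 < p) {X : TwoLevel V} (hX : IsGeometric p T X)
    (hτ : IsClock T τ) (hx : OfOrder (simplex T) (gap τ) (1 / p) fun z => X.path z.2 - X.path z.1)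
    {F : V → W} (hC2 : ContDiff ℝ 2 F) {M κ : ℝ} (hM : 0 ≤ M) (hκ : 0 ≤ κ)
    (hM1 : ∀ x, ‖fderiv ℝ F x‖ ≤ M) (hM2 : ∀ x, ‖fderiv ℝ (fderiv ℝ F) x‖ ≤ M)
    (hH : ∀ x y, ‖fderiv ℝ (fderiv ℝ F) y - fderiv ℝ (fderiv ℝ F) x‖ ≤ M * ‖y - x‖ ^ κ) :
    OfOrder (simplex T) (gap τ) (1 / p) (fun z => F (X.path z.2) - F (X.path z.1)) ∧
    OfOrder (simplex T) (gap τ) (1 / p)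
      (fun z => fderiv ℝ F (X.path z.2) - fderiv ℝ F (X.path z.1)) ∧
    OfOrder (simplex T) (gap τ) (1 / p * κ)
      (fun z => hess F (X.path z.2) - hess F (X.path z.1)) ∧
    OfOrder (simplex T) (gap τ) (1 / p * 2) (fun z => F (X.path z.2) - F (X.path z.1) -
      fderiv ℝ F (X.path z.1) (X.path z.2 - X.path z.1)) ∧
    OfOrder (simplex T) (gap τ) (1 / p * κ + 1 / p * 2) (fun z => F (X.path z.2) -
      F (X.path z.1) - fderiv ℝ F (X.path z.1) (X.path z.2 - X.path z.1) -
      hess F (X.path z.1) (X.snd z.1 z.2)) := by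
  have hρ := hτ.isGauge
  have hd0 : Differentiable ℝ F := hC2.differentiable (by norm_num)
  have hd1 : Differentiable ℝ (fderiv ℝ F) :=
    (hC2.fderiv_right (m := 1) (by norm_num)).differentiable (by norm_num)
  have hlip0 : ∀ y z, ‖F z - F y‖ ≤ M * ‖z - y‖ := fun y z =>
    convex_univ.norm_image_sub_le_of_norm_fderiv_le (𝕜 := ℝ) (f := F) (fun z _ => hd0 z)
      (fun z _ => hM1 z) (mem_univ y) (mem_univ z)
  have hlip1 : ∀ y z, ‖fderiv ℝ F z - fderiv ℝ F y‖ ≤ M * ‖z - y‖ := fun y z =>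
    convex_univ.norm_image_sub_le_of_norm_fderiv_le (𝕜 := ℝ) (f := fderiv ℝ F) (fun z _ => hd1 z)
      (fun z _ => hM2 z) (mem_univ y) (mem_univ z)
  refine ⟨hx.of_norm_le M hM fun z _ => hlip0 _ _, hx.of_norm_le M hM fun z _ => hlip1 _ _,
    ?_, ?_, ?_⟩
  · have h1 : OfOrder (simplex T) (gap τ) (1 / p * κ)
        fun z => fderiv ℝ (fderiv ℝ F) (X.path z.2) - fderiv ℝ (fderiv ℝ F) (X.path z.1) :=
      (hx.norm_rpow hρ hκ).of_norm_le M hM fun z _ => by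
        rw [Real.norm_of_nonneg (by positivity)]
        exact hH _ _
    refine (h1.clm (tensorLiftL V W)).congr fun z _ => ?_
    rw [map_sub]
    rfl
  · refine (hx.norm_rpow hρ zero_le_two).of_norm_le M hM fun z _ => ?_
    rw [Real.norm_of_nonneg (by positivity), show (2 : ℝ) = 1 + 1 by norm_num]
    exact norm_taylor_one_le hd0 hM zero_le_one (by simpa using hlip1) _ _
  · have h1 := hx.norm_rpow hρ (c := 2 + κ) (by linarith)
    rw [show 1 / p * (2 + κ) = 1 / p * κ + 1 / p * 2 by ring] at h1
    refine h1.of_norm_le M hM fun z hz => ?_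
    rw [Real.norm_of_nonneg (by positivity)]
    have h2 := hX.tensorLift_snd hp (B := fderiv ℝ (fderiv ℝ F) (X.path z.1))
      (second_derivative_symmetric (fun z => (hd0 z).hasFDerivAt) (hd1 _).hasFDerivAt)
      hz.1 hz.2.1 hz.2.2
    rw [hX.1.fst_eq hz.1 hz.2.1 hz.2.2] at h2
    rw [hess, h2]
    exact norm_taylor_two_le hC2 hM hκ hH _ _

end Ito

end RoughIto

theorem mainTheorem3 (d e : ℕ) (p γ q T : ℝ) (hp : 2 ≤ p) (hp3 : p < 3) (hγ : p < γ)
    (hq : 0 < q) (hqp : q ≤ p / 2) (hT : 0 < T)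
    (X : RoughIto.TwoLevel (EuclideanSpace ℝ (Fin d))) (hX : RoughIto.IsGeometric p T X)
    (φ : ℝ → EuclideanSpace ℝ (Fin d) ⊗[ℝ] EuclideanSpace ℝ (Fin d))
    (hφc : ContinuousOn φ (Set.Icc 0 T))
    (hφ : RoughIto.variation q (RoughIto.increment φ) 0 T ≠ ∞)
    (F : EuclideanSpace ℝ (Fin d) → EuclideanSpace ℝ (Fin e)) (hF : RoughIto.IsLip γ F) :
    -- the rough integrals `F_R(X) = ∫ DF(X) dX` and `∫ DF(X(φ)) dX(φ)` exist
    RoughIto.IsRoughPath p T (X.perturb φ) ∧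
    RoughIto.IsRoughIntegral p T (fderiv ℝ F) X (RoughIto.image p T F X) ∧
    RoughIto.IsRoughIntegral p T (fderiv ℝ F) (X.perturb φ)
      (RoughIto.roughIntegral p T (fderiv ℝ F) (X.perturb φ)) ∧
    ∀ s t : ℝ, 0 ≤ s → s ≤ t → t ≤ T →
      -- (i)
      (RoughIto.image p T F X).fst s t = F (X.path t) - F (X.path s) ∧
      -- (ii)
      RoughIto.YoungIntegrable (fun u => RoughIto.hess F (X.path u)) φ s t ∧
      F (X.path t) - F (X.path s) =
        (RoughIto.roughIntegral p T (fderiv ℝ F) (X.perturb φ)).fst s t +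
          RoughIto.youngIntegral (fun u => RoughIto.hess F (X.path u)) φ s t ∧
      -- (iii)
      RoughIto.YoungIntegrable (fun u => RoughIto.tensorSq (fderiv ℝ F (X.path u))) φ s t ∧
      RoughIto.YoungIntegrable
        (fun u => TensorProduct.mkL ℝ _ _
          (RoughIto.youngIntegral (fun r => RoughIto.hess F (X.path r)) φ s u))
        (fun u => F (X.path u)) s t ∧
      RoughIto.YoungIntegrable
        (fun u => (TensorProduct.mkL ℝ _ _ (F (X.path u) - F (X.path s))).comp
          (RoughIto.hess F (X.path u))) φ s t ∧
      RoughIto.YoungIntegrable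
        (fun u => (TensorProduct.mkL ℝ _ _
          (RoughIto.youngIntegral (fun r => RoughIto.hess F (X.path r)) φ s u)).comp
          (RoughIto.hess F (X.path u))) φ s t ∧
      (RoughIto.image p T F X).snd s t =
        (RoughIto.roughIntegral p T (fderiv ℝ F) (X.perturb φ)).snd s t +
        RoughIto.youngIntegral (fun u => RoughIto.tensorSq (fderiv ℝ F (X.path u))) φ s t +
        RoughIto.youngIntegral
          (fun u => TensorProduct.mkL ℝ _ _
            (RoughIto.youngIntegral (fun r => RoughIto.hess F (X.path r)) φ s u))
          (fun u => F (X.path u)) s t +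
        RoughIto.youngIntegral
          (fun u => (TensorProduct.mkL ℝ _ _ (F (X.path u) - F (X.path s))).comp
            (RoughIto.hess F (X.path u))) φ s t -
        RoughIto.youngIntegral
          (fun u => (TensorProduct.mkL ℝ _ _
            (RoughIto.youngIntegral (fun r => RoughIto.hess F (X.path r)) φ s u)).comp
            (RoughIto.hess F (X.path u))) φ s t := by
  have hp0 : 0 < p := by linarith
  obtain ⟨τ, hτ, hx, hX2, hφo⟩ := hX.1.exists_clock hp0 hφc
    (RoughIto.variation_ne_top_of_le hq hqp hφ)
  obtain ⟨hC2, M, hM, hM1, hM2, hH⟩ := hF.exists_bound (by linarith)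
  -- With `κ` the Hölder exponent of `D²F`, the number `(κ + 2) / p` exceeds `1`.
  have hκp : p - 2 < min γ 3 - 2 := by linarith [lt_min hγ hp3]
  have hκ : 0 < min γ 3 - 2 := by linarith
  have hκ1 : min γ 3 - 2 ≤ 1 := by linarith [min_le_right γ 3]
  have hα2 : 1 / p * 2 ≤ 1 := by
    rw [one_div_mul_eq_div, div_le_one hp0]
    exact hp
  have hθ : 1 < 1 / p * (min γ 3 - 2) + 1 / p * 2 := by
    rw [← mul_add, one_div_mul_eq_div, lt_div_iff₀ hp0]
    linarith
  obtain ⟨hfo, hgo, hho, htay1, htay2⟩ :=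
    RoughIto.order_of_taylor hp0 hX hτ hx hC2 hM hκ.le hM1 hM2 hH
  exact ⟨hX.1.perturb hp0 hτ hφc hX2 hφo,
    RoughIto.ito_formula_of_order (f := fun u => F (X.path u))
      (g := fun u => fderiv ℝ F (X.path u)) (h := fun u => RoughIto.hess F (X.path u)) hp0 hT.le hτ
      hX.1 hκ hκ1 hα2 hθ (fun _ => rfl) (fun _ => rfl) hx hX2 hφo hfo hgo hho htay1 htay2⟩
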